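/- **Notation.** Let $\mathbb A=[0,1]\times\mathbb R/\mathbb Z$ with universal covering $q:[0,1]\times\mathbb R\to\mathbb A$, $q(s,r)=(s,r+\mathbb Z)$. Let $d$ be the sum of the standard metrics of the two factors of $\mathbb A$, and for homeomorphisms $F,G$ of $\mathbb A$ let $\rho(F,G)=\max\{\sup_x d(F(x),G(x)),\ \sup_x d(F^{-1}(x),G^{-1}(x))\}$. **HAK homeomorphisms.** A homeomorphism $H:\mathbb A\to\mathbb A$ is a *Handel–Anosov–Katok (HAK) homeomorphism* with *attractor* $\Psi=\bigcap_{n\ge1}A_n$ if there are closed annuli $A_1\supset A_2\supset\cdots$ in $\mathbb A$ (subsets homeomorphic to $\mathbb A$) with $A_1\subset(0,1)\times\mathbb R/\mathbb Z$, numbers $\varepsilon_n>0$ with $\sum_n\varepsilon_n<\infty$, and, for every $n\ge1$, homeomorphisms $f_n:A_n\to\mathbb A$ and $g_n:\mathbb A\to\mathbb A$, a rigid rotation $R_n(s,\theta)=(s,\theta+r_n)$ with $r_n\in\mathbb Q$ and least period $p_n$, a number $w_n>0$ and an integer $m_n\ge1$ such that, with $H_n=g_n\circ\cdots\circ g_1$,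 $D_n=[0,1]\times[0,w_n]\subset\mathbb A$ and $A_0=\mathbb A$: 1. each set $f_n^{-1}([0,1]\times\{\theta\})$, $\theta\in\mathbb R/\mathbb Z$, has $d$-diameter less than $\varepsilon_n/2$; 2. there is $\delta_n>w_n$ such that $d(u,v)<\delta_n$ implies $d(f_n^{-1}(u),f_n^{-1}(v))<\varepsilon_n/4$; any two of the sets $R_n^i(D_n)$, $i\in\mathbb Z$, are equal or have disjoint interiors; these sets cover $\mathbb A$; and $p_{n+1}\ge p_n$; 3. $\rho(g_n,\mathrm{id})<\varepsilon_n$, $g_n=\mathrm{id}$ on $\mathbb A\setminus A_{n-1}$, and $H_n|_{A_n}=f_n^{-1}\circ R_n\circ f_n$; 4. $H_n(A_{n+1})=A_{n+1}$; 5. $\rho(H_n^i,H_{n+1}^i)<\varepsilon_n$ for $i=1,\dots,m_np_n$; 6. $\rho(H_n,H)\to0$ as $n\to\infty$. Then $H(\Psi)=\Psi$. A *lift* of $H$ is a homeomorphism $\tilde H$ of $[0,1]\times\mathbb R$ with $q\circ\tilde H=H\circ q$ that commutes with the translation $(s,r)\mapsto(s,r+1)$. It has *rotation number* $\alpha\in\mathbb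 R$ on $\Psi$ if $\frac1n\big(\tilde\pi(\tilde H^n(y))-\tilde\pi(y)\big)\to\alpha$ for every $y\in q^{-1}(\Psi)$, where $\tilde\pi(s,r)=r$. **Pseudo-suspension.** Let $C$ be a Cantor set and $h:C\to C$ a homeomorphism. Let $([0,1]\times\mathbb R)_C$ be the quotient of $([0,1]\times\mathbb R)\times C$ by the relation $((s,r),c)\approx((s,r+n),h^{-n}(c))$, $n\in\mathbb Z$, and let $q_C:([0,1]\times\mathbb R)_C\to\mathbb A$, $q_C([x,c])=q(x)$. The *pseudo-suspension* of $h$ is $\Psi_C=q_C^{-1}(\Psi)$, a compact Hausdorff space. A lift $\tilde H$ of $H$ induces the lifted homeomorphism $H_C:\Psi_C\to\Psi_C$, $H_C([x,c])=[\tilde H(x),c]$. **Theorem 6.1.** Let $H$ be a HAK homeomorphism with attractor $\Psi$, let $\tilde H$ be a lift of $H$ with rotation number $\alpha\neq0$ on $\Psi$, and let $h:C\to C$ be a homeomorphism of a Cantor set. Then the homeomorphism $H_C:\Psi_C\to\Psi_C$ induced by $\tilde H$ satisfies $$h_{\mathrm{top}}(H_C)=|\alpha|\,h_{\mathrm{top}}(h),$$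 as an identity in $[0,\infty]$. -/

import Mathlib

open Set Filter Topology Function

namespace HAK

/-! ### The closed annulus and its universal cover -/

/-- The closed annulus `[0,1] × ℝ/ℤ`. -/
abbrev Annulus : Type := unitInterval × UnitAddCircle

/-- The universal cover `[0,1] × ℝ` of the annulus. -/
abbrev Strip : Type := unitInterval × ℝ

/-- The covering map `q = id × p : [0,1] × ℝ → [0,1] × ℝ/ℤ`. -/
def cov (x : Strip) : Annulus := (x.1, (x.2 : UnitAddCircle))

/-- The rotation invariant metric `d` on the annulus: the sum of the distances of the coordinates
in `[0,1]` and in `ℝ/ℤ` (`Prod` itself carries the maximum of the two). -/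
noncomputable def annDist (x y : Annulus) : ℝ := dist x.1 y.1 + dist x.2 y.2

/-- The standard complete `C⁰` metric `ρ` on the self-homeomorphisms of the annulus. -/
noncomputable def rho (f g : Annulus ≃ₜ Annulus) : ℝ :=
  max (⨆ x, annDist (f x) (g x)) (⨆ x, annDist (f.symm x) (g.symm x))

/-- The rigid rotation of the annulus by the angle `θ`. -/
noncomputable def rotation (θ : UnitAddCircle) : Annulus ≃ₜ Annulus :=
  (Homeomorph.refl unitInterval).prodCongr (Homeomorph.addRight θ)

/-- The rectangle `[0,1] × [0,a]`, as a subset of the annulus. -/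
def rectangle (a : ℝ) : Set Annulus := cov '' (univ ×ˢ Icc 0 a)

/-- The compositions `g n ∘ ⋯ ∘ g 1 ∘ g 0`. -/
def compSeq (g : ℕ → (Annulus ≃ₜ Annulus)) : ℕ → (Annulus ≃ₜ Annulus)
  | 0 => g 0
  | n + 1 => g (n + 1) * compSeq g n

/-! ### Handel–Anosov–Katok homeomorphisms -/

/-- An approximation scheme exhibiting `H` as a Handel–Anosov–Katok homeomorphism.
All sequences are indexed from `0`, and the annulus preceding `A 0` is the whole annulus. -/
structure HAKScheme (H : Annulus ≃ₜ Annulus) where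
  /-- the decreasing closed annuli -/
  A : ℕ → Set Annulus
  A_anti : ∀ n, A (n + 1) ⊆ A n
  /-- the first one lies in the interior `(0,1) × ℝ/ℤ` of the surface -/
  A_interior : A 0 ⊆ {x | 0 < x.1 ∧ x.1 < 1}
  ε : ℕ → ℝ
  ε_pos : ∀ n, 0 < ε n
  ε_summable : Summable ε
  /-- the charts identifying `A n` with the annulus -/
  f : ∀ n, A n ≃ₜ Annulus
  /-- small vertical fibres: the preimages under `f n` of the segments `[0,1] × {θ}` have diameter
  less than `ε n / 2` (a fibre is compact, so its diameter is attained) -/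
  small_fibers : ∀ n, ∀ x y : A n, (f n x).2 = (f n y).2 → annDist x y < ε n / 2
  /-- the angles of the rational rotations `R n` -/
  r : ℕ → ℚ
  /-- the widths of the rectangles `D n = [0,1] × [0, width n]` -/
  width : ℕ → ℝ
  width_pos : ∀ n, 0 < width n
  /-- `width n` is less than a `δ` witnessing uniform continuity of `(f n)⁻¹` for `ε n / 4` -/
  width_lt : ∀ n, ∃ δ, width n < δ ∧
    ∀ u v : Annulus, annDist u v < δ → annDist ((f n).symm u) ((f n).symm v) < ε n / 4
  /-- the rotated rectangles are pairwise equal or have disjoint interiors -/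
  tiles : ∀ n, ∀ i j : ℤ,
    ⇑(rotation (r n : ℝ) ^ i) '' rectangle (width n) =
        ⇑(rotation (r n : ℝ) ^ j) '' rectangle (width n) ∨
      Disjoint (interior (⇑(rotation (r n : ℝ) ^ i) '' rectangle (width n)))
        (interior (⇑(rotation (r n : ℝ) ^ j) '' rectangle (width n)))
  /-- the rotated rectangles cover the annulus -/
  tiles_cover : ∀ n, ⋃ i : ℤ, ⇑(rotation (r n : ℝ) ^ i) '' rectangle (width n) = univ
  /-- the periods `p n` of `R n` are nondecreasing -/
  period_mono : ∀ n, orderOf (rotation (r n : ℝ)) ≤ orderOf (rotation (r (n + 1) : ℝ))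
  /-- the successive perturbations; `H n = g n ∘ ⋯ ∘ g 0` is `compSeq g n` -/
  g : ℕ → (Annulus ≃ₜ Annulus)
  g_close : ∀ n, rho (g n) (Homeomorph.refl Annulus) < ε n
  g_support : ∀ n, ∀ x ∉ A n, g (n + 1) x = x
  /-- on `A n`, the approximation `H n` is conjugate by `f n` to the rational rotation `R n` -/
  conj : ∀ n, ∀ x : A n, compSeq g n x = (f n).symm (rotation (r n : ℝ) (f n x))
  invariant : ∀ n, compSeq g n '' A (n + 1) = A (n + 1)
  /-- `q n = m n * p n` is the number of iterates controlled at stage `n` -/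
  m : ℕ → ℕ
  m_pos : ∀ n, 1 ≤ m n
  iterates_close : ∀ n, ∀ i ∈ Icc 1 (m n * orderOf (rotation (r n : ℝ))),
    rho (compSeq g n ^ i) (compSeq g (n + 1) ^ i) < ε n
  /-- `H` is the limit of the `H n` -/
  limit : Tendsto (fun n => rho (compSeq g n) H) atTop (𝓝 0)

/-- The HAK attractor `Ψ`, the intersection of the nested annuli. -/
def HAKScheme.attractor {H : Annulus ≃ₜ Annulus} (S : HAKScheme H) : Set Annulus := ⋂ n, S.A n

/-! #### The attractor is invariant -/

theorem continuous_annDist {X : Type*} [TopologicalSpace X] {f g : X → Annulus}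
    (hf : Continuous f) (hg : Continuous g) : Continuous fun x => annDist (f x) (g x) := by
  unfold annDist; fun_prop

theorem annDist_le_rho (f g : Annulus ≃ₜ Annulus) (x : Annulus) :
    annDist (f x) (g x) ≤ rho f g :=
  (le_ciSup (f := fun x => annDist (f x) (g x))
    (isCompact_range (continuous_annDist f.continuous g.continuous)).bddAbove x).trans
    (le_max_left _ _)

theorem annDist_symm_le_rho (f g : Annulus ≃ₜ Annulus) (x : Annulus) :
    annDist (f.symm x) (g.symm x) ≤ rho f g :=
  (le_ciSup (f := fun x => annDist (f.symm x) (g.symm x))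
    (isCompact_range (continuous_annDist f.symm.continuous g.symm.continuous)).bddAbove x).trans
    (le_max_right _ _)

theorem dist_le_annDist (x y : Annulus) : dist x y ≤ annDist x y := by
  rw [Prod.dist_eq]
  exact max_le (le_add_of_nonneg_right dist_nonneg) (le_add_of_nonneg_left dist_nonneg)

namespace HAKScheme

variable {H : Annulus ≃ₜ Annulus} (S : HAKScheme H)

theorem isClosed_A (n : ℕ) : IsClosed (S.A n) := by
  have h : range (fun u => ((S.f n).symm u : Annulus)) = S.A n := by
    ext x
    constructor
    · rintro ⟨u, rfl⟩
      exact ((S.f n).symm u).2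
    · intro hx
      exact ⟨S.f n ⟨x, hx⟩, by simp⟩
  rw [← h]
  exact (isCompact_range (continuous_subtype_val.comp (S.f n).symm.continuous)).isClosed

theorem g_mem_iff (n : ℕ) (x : Annulus) : S.g (n + 1) x ∈ S.A n ↔ x ∈ S.A n := by
  constructor
  · intro h
    by_contra hx
    exact hx (S.g_support n x hx ▸ h)
  · intro hx
    by_contra h
    have := (S.g (n + 1)).injective (S.g_support n _ h)
    exact h (this.symm ▸ hx)

theorem compSeq_mem_iff (n m : ℕ) (hnm : n ≤ m) (x : Annulus) :
    compSeq S.g m x ∈ S.A n ↔ x ∈ S.A n := by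
  induction m, hnm using Nat.le_induction with
  | base =>
    constructor
    · intro h
      set y : S.A n := ⟨_, h⟩ with hy
      have h1 := S.conj n ((S.f n).symm ((rotation (S.r n : ℝ)).symm (S.f n y)))
      simp only [Homeomorph.apply_symm_apply, Homeomorph.symm_apply_apply] at h1
      have h2 := (compSeq S.g n).injective (h1.trans (show (y : Annulus) = compSeq S.g n x from rfl))
      rw [← h2]
      exact Subtype.coe_prop _
    · intro h
      rw [S.conj n ⟨x, h⟩]
      exact Subtype.coe_prop _
  | succ m hnm ih =>
    have hsub : S.A m ⊆ S.A n := antitone_nat_of_succ_le S.A_anti hnm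
    have hg : ∀ z, S.g (m + 1) z ∈ S.A n ↔ z ∈ S.A n := by
      intro z
      by_cases hz : z ∈ S.A m
      · exact ⟨fun _ => hsub hz, fun _ => hsub ((S.g_mem_iff m z).2 hz)⟩
      · rw [S.g_support m z hz]
    exact (hg _).trans ih

theorem tendsto_compSeq (x : Annulus) :
    Tendsto (fun n => compSeq S.g n x) atTop (𝓝 (H x)) :=
  tendsto_iff_dist_tendsto_zero.2 <| squeeze_zero (fun _ => dist_nonneg)
    (fun _ => (dist_le_annDist _ _).trans (annDist_le_rho _ _ x)) S.limit

theorem tendsto_compSeq_symm (x : Annulus) :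
    Tendsto (fun n => (compSeq S.g n).symm x) atTop (𝓝 (H.symm x)) :=
  tendsto_iff_dist_tendsto_zero.2 <| squeeze_zero (fun _ => dist_nonneg)
    (fun _ => (dist_le_annDist _ _).trans (annDist_symm_le_rho _ _ x)) S.limit

theorem mem_A_iff (n : ℕ) (x : Annulus) : H x ∈ S.A n ↔ x ∈ S.A n := by
  constructor
  · intro h
    have := (S.isClosed_A n).mem_of_tendsto (S.tendsto_compSeq_symm (H x))
      (eventually_atTop.2 ⟨n, fun m hm => by
        rw [← S.compSeq_mem_iff n m hm, Homeomorph.apply_symm_apply]; exact h⟩)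
    simpa using this
  · intro h
    exact (S.isClosed_A n).mem_of_tendsto (S.tendsto_compSeq x)
      (eventually_atTop.2 ⟨n, fun m hm => (S.compSeq_mem_iff n m hm x).2 h⟩)

theorem mem_attractor_iff (x : Annulus) : H x ∈ S.attractor ↔ x ∈ S.attractor := by
  simp only [attractor, mem_iInter, S.mem_A_iff]

end HAKScheme

/-! ### Lifts to the universal cover and rotation numbers -/

/-- A lift of `H` to the universal cover, commuting with the deck transformations. These are the
end maps of the lifts, starting at the identity, of the homotopies from the identity to `H`. -/
structure Lift (H : Annulus ≃ₜ Annulus) where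
  toHomeo : Strip ≃ₜ Strip
  cov_apply : ∀ x, cov (toHomeo x) = H (cov x)
  map_translate : ∀ x : Strip,
    toHomeo (x.1, x.2 + 1) = ((toHomeo x).1, (toHomeo x).2 + 1)

theorem Lift.map_translate_int {H : Annulus ≃ₜ Annulus} (L : Lift H) (n : ℤ) :
    ∀ x : Strip, L.toHomeo (x.1, x.2 + n) = ((L.toHomeo x).1, (L.toHomeo x).2 + n) := by
  induction n using Int.induction_on with
  | zero => simp
  | succ n ih =>
    intro x
    have h := L.map_translate (x.1, x.2 + (n : ℤ))
    rw [ih x] at h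
    push_cast at h ⊢
    simpa only [add_assoc] using h
  | pred n ih =>
    intro x
    have h := L.map_translate (x.1, x.2 + ((-(n : ℤ) - 1 : ℤ) : ℝ))
    have e : x.2 + ((-(n : ℤ) - 1 : ℤ) : ℝ) + 1 = x.2 + ((-(n : ℤ) : ℤ) : ℝ) := by
      push_cast; ring
    simp only [e, ih x] at h
    have h1 := congrArg Prod.fst h
    have h2 := congrArg Prod.snd h
    refine Prod.ext h1.symm ?_
    push_cast at h2 ⊢
    linarith

/-- Every point of `Ψ` has rotation number `α` with respect to the lift `L`: the average angular
displacement along every orbit over `Ψ` converges to `α`. -/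
def Lift.HasRotationNumber {H : Annulus ≃ₜ Annulus} (L : Lift H) (Ψ : Set Annulus) (α : ℝ) :
    Prop :=
  ∀ y : Strip, cov y ∈ Ψ →
    Tendsto (fun n : ℕ => ((L.toHomeo^[n] y).2 - y.2) / n) atTop (𝓝 α)

/-! ### The fibre bundle over the annulus determined by a homeomorphism of the fibre -/

section Suspension

variable {C : Type*} [TopologicalSpace C]

/-- `((s, r), c) ≈ ((s', r'), c')` iff `s = s'` and `r' = r + n`, `c' = h⁻ⁿ(c)` for some `n : ℤ`. -/
def suspSetoid (h : C ≃ₜ C) : Setoid (Strip × C) where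
  r x y := x.1.1 = y.1.1 ∧ ∃ n : ℤ, y.1.2 = x.1.2 + n ∧ y.2 = (h ^ (-n)) x.2
  iseqv :=
    { refl := fun x => ⟨rfl, 0, by simp, by simp⟩
      symm := by
        rintro x y ⟨h1, n, h2, h3⟩
        refine ⟨h1.symm, -n, by rw [h2]; push_cast; ring, ?_⟩
        rw [h3, ← Homeomorph.mul_apply, ← zpow_add]
        simp
      trans := by
        rintro x y z ⟨h1, n, h2, h3⟩ ⟨k1, m, k2, k3⟩
        refine ⟨h1.trans k1, n + m, by rw [k2, h2]; push_cast; ring, ?_⟩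
        rw [k3, h3, ← Homeomorph.mul_apply, ← zpow_add, neg_add_rev] }

/-- The total space `([0,1] × ℝ)_C = ([0,1] × ℝ) × C / ≈`. -/
def SuspSpace (h : C ≃ₜ C) : Type _ := Quotient (suspSetoid h)

/-- The quotient topology. -/
instance (h : C ≃ₜ C) : TopologicalSpace (SuspSpace h) :=
  inferInstanceAs (TopologicalSpace (Quotient (suspSetoid h)))

/-- The quotient map `Q`. -/
def quot (h : C ≃ₜ C) (x : Strip × C) : SuspSpace h := Quotient.mk (suspSetoid h) x

theorem isQuotientMap_quot (h : C ≃ₜ C) : IsQuotientMap (quot h) := isQuotientMap_quotient_mk'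

theorem quot_eq_iff (h : C ≃ₜ C) (x y : Strip × C) : quot h x = quot h y ↔
    x.1.1 = y.1.1 ∧ ∃ n : ℤ, y.1.2 = x.1.2 + n ∧ y.2 = (h ^ (-n)) x.2 := Quotient.eq

theorem quot_translate (h : C ≃ₜ C) (n : ℤ) (x : Strip × C) :
    quot h ((x.1.1, x.1.2 + n), (h ^ (-n)) x.2) = quot h x :=
  ((quot_eq_iff h x ((x.1.1, x.1.2 + n), (h ^ (-n)) x.2)).2 ⟨rfl, n, rfl, rfl⟩).symm

theorem cov_add_int (s : unitInterval) (t : ℝ) (n : ℤ) : cov (s, t + n) = cov (s, t) := by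
  refine Prod.ext rfl ?_
  simp [cov]

/-- The bundle projection `q_C : ([0,1] × ℝ)_C → [0,1] × ℝ/ℤ`, `[x, c] ↦ q x`. -/
def bundleProj (h : C ≃ₜ C) : SuspSpace h → Annulus :=
  Quotient.lift (fun x : Strip × C => cov x.1) (by
    rintro ⟨⟨s, t⟩, c⟩ ⟨⟨s', t'⟩, c'⟩ ⟨h1, n, h2, -⟩
    simp only at h1 h2
    subst h1 h2
    exact (cov_add_int s t n).symm)

theorem continuous_cov : Continuous cov := by
  unfold cov
  exact continuous_fst.prodMk ((AddCircle.continuous_mk' 1).comp continuous_snd)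

theorem continuous_bundleProj (h : C ≃ₜ C) : Continuous (bundleProj h) :=
  (continuous_cov.comp continuous_fst).quotient_lift _

theorem isOpenMap_quot (h : C ≃ₜ C) : IsOpenMap (quot h) := by
  intro U hU
  rw [← (isQuotientMap_quot h).isOpen_preimage]
  have : quot h ⁻¹' (quot h '' U) =
      ⋃ n : ℤ, (fun x : Strip × C => (((x.1.1, x.1.2 + n) : Strip), (h ^ (-n)) x.2)) ⁻¹' U := by
    ext x
    simp only [mem_preimage, mem_image, mem_iUnion]
    constructor
    · rintro ⟨y, hy, hxy⟩
      obtain ⟨h1, n, h2, h3⟩ := (quot_eq_iff h _ _).1 hxy.symm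
      refine ⟨n, ?_⟩
      convert hy using 1
      exact Prod.ext (Prod.ext h1 h2.symm) h3.symm
    · rintro ⟨n, hn⟩
      exact ⟨_, hn, quot_translate h n x⟩
  rw [this]
  exact isOpen_iUnion fun n => hU.preimage (by fun_prop)

instance (h : C ≃ₜ C) [CompactSpace C] : CompactSpace (SuspSpace h) := by
  have hc : Continuous fun x : (unitInterval × unitInterval) × C =>
      quot h ((x.1.1, (x.1.2 : ℝ)), x.2) :=
    (isQuotientMap_quot h).continuous.comp (by fun_prop)
  have hs : Surjective fun x : (unitInterval × unitInterval) × C =>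
      quot h ((x.1.1, (x.1.2 : ℝ)), x.2) := by
    intro z
    obtain ⟨⟨⟨s, t⟩, c⟩, rfl⟩ := (isQuotientMap_quot h).surjective z
    refine ⟨((s, ⟨Int.fract t, Int.fract_nonneg t, (Int.fract_lt_one t).le⟩),
      (h ^ ⌊t⌋) c), ?_⟩
    have := quot_translate h (-⌊t⌋) ((s, t), c)
    rw [← this]
    simp [Int.fract, sub_eq_add_neg]
  exact hs.compactSpace hc

instance (h : C ≃ₜ C) [T2Space C] : T2Space (SuspSpace h) := by
  refine ⟨fun z w hzw => ?_⟩
  by_cases hb : bundleProj h z = bundleProj h w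
  · obtain ⟨⟨⟨s, t⟩, c⟩, rfl⟩ := (isQuotientMap_quot h).surjective z
    obtain ⟨⟨⟨s', t'⟩, c'⟩, rfl⟩ := (isQuotientMap_quot h).surjective w
    have hb' : cov (s, t) = cov (s', t') := hb
    have h1 : s = s' := congrArg Prod.fst hb'
    have h2 : (t' : UnitAddCircle) = (t : UnitAddCircle) := (congrArg Prod.snd hb').symm
    obtain ⟨n, hn⟩ := AddCircle.coe_eq_zero_iff (p := (1 : ℝ)).1
      (show ((t - t' : ℝ) : UnitAddCircle) = 0 by rw [AddCircle.coe_sub, h2, sub_self])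
    have hn' : t' + n = t := by
      rw [zsmul_eq_mul, mul_one] at hn
      linarith
    have hw : quot h ((s', t'), c') = quot h ((s, t), (h ^ (-n)) c') := by
      rw [← quot_translate h n ((s', t'), c')]
      simp only [hn', h1]
    rw [hw] at hzw ⊢
    have hne : c ≠ (h ^ (-n)) c' := fun hc => hzw (by rw [← hc])
    obtain ⟨U, V, hU, hV, hcU, hcV, hUV⟩ := t2_separation hne
    have hW : IsOpen {x : Strip | dist x.2 t < 1 / 2} :=
      isOpen_lt (by fun_prop) continuous_const
    refine ⟨quot h '' ({x : Strip | dist x.2 t < 1 / 2} ×ˢ U),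
      quot h '' ({x : Strip | dist x.2 t < 1 / 2} ×ˢ V), isOpenMap_quot h _ (hW.prod hU),
      isOpenMap_quot h _ (hW.prod hV), ⟨_, ⟨by simp, hcU⟩, rfl⟩, ⟨_, ⟨by simp, hcV⟩, rfl⟩, ?_⟩
    rw [Set.disjoint_left]
    rintro _ ⟨x, ⟨hx, hxU⟩, rfl⟩ ⟨y, ⟨hy, hyV⟩, hyx⟩
    obtain ⟨-, m, hm, hm'⟩ := (quot_eq_iff h _ _).1 hyx
    simp only [Set.mem_ofPred_eq, Real.dist_eq, abs_lt] at hx hy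
    have hm0 : m = 0 := by
      have a1 : (-1 : ℝ) < m := by linarith
      have a2 : (m : ℝ) < 1 := by linarith
      have b1 : -1 < m := by exact_mod_cast a1
      have b2 : m < 1 := by exact_mod_cast a2
      omega
    subst hm0
    simp only [neg_zero, zpow_zero, Homeomorph.one_apply] at hm'
    exact Set.disjoint_left.1 hUV hxU (hm' ▸ hyV)
  · exact separated_by_continuous (continuous_bundleProj h) hb

/-- The unique uniform structure of the compact Hausdorff space `([0,1] × ℝ)_C`. -/
noncomputable instance (h : C ≃ₜ C) [CompactSpace C] [T2Space C] : UniformSpace (SuspSpace h) :=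
  uniformSpaceOfCompactR1

/-! ### Pseudo-suspensions and lifted homeomorphisms -/

/-- The pseudo-suspension `Ψ_C = q_C⁻¹(Ψ)`. -/
def pseudoSusp (h : C ≃ₜ C) (Ψ : Set Annulus) : Set (SuspSpace h) := bundleProj h ⁻¹' Ψ

variable {H : Annulus ≃ₜ Annulus}

theorem Lift.rel_iff (L : Lift H) (h : C ≃ₜ C) (x y : Strip × C) :
    (suspSetoid h).r x y ↔ (suspSetoid h).r (L.toHomeo x.1, x.2) (L.toHomeo y.1, y.2) := by
  constructor
  · rintro ⟨h1, n, h2, h3⟩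
    have e : y.1 = (x.1.1, x.1.2 + n) := Prod.ext h1.symm h2
    refine ⟨?_, n, ?_, h3⟩ <;> simp only [e, L.map_translate_int]
  · rintro ⟨h1, n, h2, h3⟩
    have e : L.toHomeo (x.1.1, x.1.2 + n) = L.toHomeo y.1 := by
      rw [L.map_translate_int]
      exact Prod.ext h1 h2.symm
    have e' : ((x.1.1, x.1.2 + n) : Strip) = y.1 := L.toHomeo.injective e
    exact ⟨(Prod.ext_iff.1 e').1, n, (Prod.ext_iff.1 e').2.symm, h3⟩

/-- The homeomorphism `[x, c] ↦ [H̃ x, c]` of `([0,1] × ℝ)_C` determined by a lift `H̃` of `H`. -/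
def suspHomeo (h : C ≃ₜ C) (L : Lift H) : SuspSpace h ≃ₜ SuspSpace h where
  toEquiv := Quotient.congr (L.toHomeo.toEquiv.prodCongr (Equiv.refl C)) (L.rel_iff h)
  continuous_toFun := by
    refine (isQuotientMap_quot h).continuous_iff.2 ?_
    exact (isQuotientMap_quot h).continuous.comp
      (f := fun x : Strip × C => (L.toHomeo x.1, x.2)) (by fun_prop)
  continuous_invFun := by
    refine (isQuotientMap_quot h).continuous_iff.2 ?_
    exact (isQuotientMap_quot h).continuous.comp
      (f := fun x : Strip × C => (L.toHomeo.symm x.1, x.2)) (by fun_prop)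

theorem suspHomeo_quot (h : C ≃ₜ C) (L : Lift H) (x : Strip) (c : C) :
    suspHomeo h L (quot h (x, c)) = quot h (L.toHomeo x, c) := rfl

theorem bundleProj_suspHomeo (h : C ≃ₜ C) (L : Lift H) (z : SuspSpace h) :
    bundleProj h (suspHomeo h L z) = H (bundleProj h z) := by
  obtain ⟨⟨x, c⟩, rfl⟩ := (isQuotientMap_quot h).surjective z
  exact L.cov_apply x

/-- The lifted homeomorphism `H_C : Ψ_C → Ψ_C` of the pseudo-suspension of the attractor. -/
def pseudoSuspHomeo (h : C ≃ₜ C) (S : HAKScheme H) (L : Lift H) :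
    pseudoSusp h S.attractor ≃ₜ pseudoSusp h S.attractor :=
  (suspHomeo h L).subtype fun z => by
    change bundleProj h z ∈ S.attractor ↔ bundleProj h (suspHomeo h L z) ∈ S.attractor
    rw [bundleProj_suspHomeo, S.mem_attractor_iff]

end Suspension

end HAK

/-! In the chart that brings the real coordinate back to `[0,1)`, the point `[x, c]` has fibre
coordinate `h ^ k` applied to `c`, where `k` is the integer part of the real coordinate of `x`. So
`H_C` applies `h` or its inverse whenever an orbit crosses an integer level. The formula follows
from two facts about the base.

Uniform speed: over the attractor, the displacement after `N` steps is `α * N` up to `η * N + B`,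
with `B` independent of the point (`exists_abs_disp_sub_le`). After one period `p` of `R n`, every
point of `A n` almost returns, so its displacement is almost an integer. This integer is constant
because `A n` is connected, and averaging along an orbit compares it with `α * p`.

Zero entropy of the base: up to time `p` the orbits in `A n` are followed by those of a rotation
with at most `p` tiles. Hence `p` codes describe `p` steps, which is subexponential
(`exists_annulus_code`, lifted in `exists_strip_code`).

For `≥`, a single fibre suffices: its orbit visits, up to bounded gaps, about `|α| * N` consecutive
integer levels, so a cover for `H_C` yields one for `h` (`exists_cover_fibre_of_cover`). For `≤`, a
cover for `h` of length about `|α| * N` together with the base codes yields a cover for `H_C`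
(`exists_cover_of_cover_fibre`). -/

namespace HAK

/-! ### Entropy through dynamical covers -/

section Entropy

open Dynamics Uniformity

variable {X : Type*}

theorem exists_isDynCoverOf_of_small {ι : Type*} {T : X → X} {F : Set X} {U : SetRel X X} {n : ℕ}
    (t : Finset ι) (P : ι → Set X) (hP : ∀ x ∈ F, ∃ i ∈ t, x ∈ P i)
    (hs : ∀ i ∈ t, ∀ x ∈ P i, ∀ y ∈ P i, (x, y) ∈ dynEntourage T U n) :
    ∃ s : Finset X, IsDynCoverOf T F U n s ∧ s.card ≤ t.card := by
  classical
  rcases isEmpty_or_nonempty X with hX | ⟨⟨x₀⟩⟩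
  · exact ⟨∅, fun x => (hX.false x).elim, by simp⟩
  · let c : ι → X := fun i => if hi : (P i).Nonempty then hi.some else x₀
    refine ⟨t.image c, fun x hx => ?_, Finset.card_image_le⟩
    obtain ⟨i, hi, hxi⟩ := hP x hx
    refine ⟨c i, Finset.mem_coe.2 (Finset.mem_image_of_mem c hi), ?_⟩
    have hne : (P i).Nonempty := ⟨x, hxi⟩
    refine hs i hi x hxi _ ?_
    simp only [c, dif_pos hne]
    exact hne.some_mem

variable [UniformSpace X]

/-- Covers of an invariant set can be concatenated, so one good time `n` per entourage bounds the
entropy. This is what makes it enough to code base orbits at selected times only. -/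
theorem coverEntropy_le_of_exists_isDynCoverOf {T : X → X} {F : Set X} (hF : MapsTo T F F) {c : ℝ}
    (hc : ∀ U ∈ 𝓤 X, ∀ c' > c, ∃ n : ℕ, n ≠ 0 ∧ ∃ s : Finset X, IsDynCoverOf T F U n s ∧
      (s.card : ℝ) ≤ Real.exp (c' * n)) :
    coverEntropy T F ≤ (c : EReal) := by
  refine iSup₂_le fun U hU => ?_
  obtain ⟨V, hV, hsymm, hVU⟩ := comp_symm_mem_uniformity_sets hU
  refine (coverEntropyEntourage_antitone T F hVU).trans ?_
  refine EReal.le_of_forall_lt_iff_le.1 fun c' hc' => ?_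
  obtain ⟨n, hn, s, hs, hcard⟩ := hc V hV c' (by exact_mod_cast hc')
  refine (hs.coverEntropyEntourage_le_log_card_div hF hn).trans ?_
  have hn0 : (0 : ℝ) < n := by positivity
  have h1 : ((s.card : ENNReal)) ≤ EReal.exp ((c' * n : ℝ) : EReal) := by
    rw [EReal.exp_coe, ← ENNReal.ofReal_natCast]
    exact ENNReal.ofReal_le_ofReal hcard
  have h2 := ENNReal.log_monotone h1
  rw [EReal.log_exp] at h2
  refine (EReal.div_le_iff_le_mul (by exact_mod_cast hn0) (EReal.natCast_ne_top n)).2 ?_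
  refine h2.trans (le_of_eq ?_)
  push_cast
  exact mul_comm _ _

theorem eventually_exists_isDynCoverOf {T : X → X} {F : Set X} {c : ℝ}
    (h : coverEntropy T F ≤ (c : EReal)) {U : SetRel X X} (hU : U ∈ 𝓤 X) {c' : ℝ} (hc' : c < c') :
    ∀ᶠ n : ℕ in atTop, ∃ s : Finset X, IsDynCoverOf T F U n s ∧
      (s.card : ℝ) ≤ Real.exp (c' * n) := by
  have h1 := (coverEntropyEntourage_le_coverEntropy T F hU).trans h
  have h2 := ExpGrowth.expGrowthSup_le_iff.1 h1 c' (by exact_mod_cast hc')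
  filter_upwards [h2] with n hn
  have e : ((c' : EReal) * n) = ((c' * n : ℝ) : EReal) := by push_cast; rfl
  rw [e, EReal.exp_coe] at hn
  have hfin : coverMincard T F U n < ⊤ := by
    rw [← ENat.toENNReal_lt_top]
    exact hn.trans_lt ENNReal.ofReal_lt_top
  obtain ⟨s, hs, hcard⟩ := (coverMincard_finite_iff T F U n).1 hfin
  refine ⟨s, hs, ?_⟩
  rw [← hcard, ENat.toENNReal_coe, ← ENNReal.ofReal_natCast] at hn
  exact (ENNReal.ofReal_le_ofReal_iff (Real.exp_pos _).le).1 hn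

end Entropy

/-! ### The metric `d` and rotations -/

theorem annDist_self (x : Annulus) : annDist x x = 0 := by simp [annDist]

theorem annDist_comm (x y : Annulus) : annDist x y = annDist y x := by
  simp [annDist, dist_comm]

theorem annDist_triangle (x y z : Annulus) : annDist x z ≤ annDist x y + annDist y z := by
  have h1 := dist_triangle x.1 y.1 z.1
  have h2 := dist_triangle x.2 y.2 z.2
  unfold annDist
  linarith

theorem norm_coe_le_abs (t : ℝ) : ‖(t : UnitAddCircle)‖ ≤ |t| := by
  rw [UnitAddCircle.norm_eq]
  simpa using round_le t 0

theorem homeomorph_pow_apply {X : Type*} [TopologicalSpace X] (f : X ≃ₜ X) (n : ℕ) (x : X) :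
    (f ^ n) x = f^[n] x := by
  induction n generalizing x with
  | zero => rfl
  | succ n ih => rw [pow_succ, Homeomorph.mul_apply, ih, iterate_succ_apply]

theorem rotation_iterate (θ : UnitAddCircle) (n : ℕ) (z : Annulus) :
    (rotation θ)^[n] z = (z.1, z.2 + n • θ) := by
  induction n with
  | zero => simp
  | succ n ih =>
    rw [iterate_succ_apply', ih, succ_nsmul, ← add_assoc]
    rfl

theorem orderOf_rotation_pos (r : ℚ) : 0 < orderOf (rotation ((r : ℝ) : UnitAddCircle)) := by
  refine orderOf_pos_iff.2 (isOfFinOrder_iff_pow_eq_one.2 ⟨r.den, r.den_pos, ?_⟩)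
  ext1 z
  rw [homeomorph_pow_apply, rotation_iterate, Homeomorph.one_apply]
  have h : r.den • ((r : ℝ) : UnitAddCircle) = 0 := by
    rw [← AddCircle.coe_nsmul, AddCircle.coe_eq_zero_iff]
    refine ⟨r.num, ?_⟩
    have := Rat.mul_den_eq_num r
    rw [zsmul_eq_mul, mul_one, nsmul_eq_mul, mul_comm]
    exact_mod_cast this.symm
  rw [h, add_zero]

/-! ### Shadowing by rational rotations and coding by tiles. -/

namespace HAKScheme

variable {H : Annulus ≃ₜ Annulus} (S : HAKScheme H)

/-- The period of the rational rotation at stage `n`. -/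
noncomputable def period (n : ℕ) : ℕ := orderOf (rotation (S.r n : ℝ))

theorem period_pos (n : ℕ) : 0 < S.period n := orderOf_rotation_pos _

theorem period_monotone : Monotone S.period := monotone_nat_of_le_succ S.period_mono

/-- The tail of the error series from stage `n` on. -/
noncomputable def tail (n : ℕ) : ℝ := ∑' k, S.ε (n + k)

theorem tendsto_tail : Tendsto S.tail atTop (𝓝 0) := by
  have := tendsto_sum_nat_add S.ε
  simp only [add_comm _ (_ : ℕ)] at this
  exact this

theorem tail_nonneg (n : ℕ) : 0 ≤ S.tail n := tsum_nonneg fun _ => (S.ε_pos _).le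

theorem tendsto_compSeq_iterate (i : ℕ) (x : Annulus) :
    Tendsto (fun k => (compSeq S.g k)^[i] x) atTop (𝓝 (H^[i] x)) := by
  have hu : TendstoUniformly (fun k => ⇑(compSeq S.g k)) H atTop := by
    rw [Metric.tendstoUniformly_iff]
    intro e he
    filter_upwards [S.limit.eventually_lt_const he] with n hn x
    rw [dist_comm]
    exact ((dist_le_annDist _ _).trans (annDist_le_rho _ _ x)).trans_lt hn
  induction i with
  | zero => exact tendsto_const_nhds
  | succ i ih =>
    simp only [iterate_succ_apply']
    exact hu.tendsto_comp H.continuous.continuousAt ih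

/-- The successive errors telescope: since the periods do not decrease, `i` stays in the controlled
range of iterates at every later stage. -/
theorem annDist_compSeq_iterate_le {n i : ℕ} (hi : i ≤ S.period n) (x : Annulus) :
    annDist ((compSeq S.g n)^[i] x) (H^[i] x) ≤ S.tail n := by
  rcases Nat.eq_zero_or_pos i with rfl | hi0
  · simpa [annDist_self] using S.tail_nonneg n
  have step : ∀ k, annDist ((compSeq S.g n)^[i] x) ((compSeq S.g (n + k))^[i] x) ≤
      ∑ j ∈ Finset.range k, S.ε (n + j) := by
    intro k
    induction k with
    | zero => simp [annDist_self]
    | succ k ih =>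
      rw [Finset.sum_range_succ]
      refine (annDist_triangle _ ((compSeq S.g (n + k))^[i] x) _).trans (add_le_add ih ?_)
      have hik : i ∈ Icc 1 (S.m (n + k) * orderOf (rotation (S.r (n + k) : ℝ))) :=
        ⟨hi0, hi.trans ((S.period_monotone (Nat.le_add_right n k)).trans
          (Nat.le_mul_of_pos_left _ (S.m_pos _)))⟩
      have := (annDist_le_rho _ _ x).trans (S.iterates_close (n + k) i hik).le
      rwa [homeomorph_pow_apply, homeomorph_pow_apply] at this
  have hlim : Tendsto (fun k => annDist ((compSeq S.g n)^[i] x) ((compSeq S.g (n + k))^[i] x))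
      atTop (𝓝 (annDist ((compSeq S.g n)^[i] x) (H^[i] x))) := by
    have hc : Continuous fun y => annDist ((compSeq S.g n)^[i] x) y :=
      continuous_annDist continuous_const continuous_id
    have := (hc.tendsto _).comp (S.tendsto_compSeq_iterate i x)
    have h2 := this.comp (tendsto_add_atTop_nat n)
    refine h2.congr fun k => ?_
    simp only [comp_apply, add_comm]
  have hsum : Summable fun k => S.ε (n + k) := by
    simpa only [add_comm] using (summable_nat_add_iff n).2 S.ε_summable
  exact le_of_tendsto' hlim fun k => (step k).trans
    (hsum.sum_le_tsum _ fun _ _ => (S.ε_pos _).le)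

theorem compSeq_iterate (n i : ℕ) (x : S.A n) :
    (compSeq S.g n)^[i] x = (S.f n).symm ((rotation (S.r n : ℝ))^[i] (S.f n x)) := by
  induction i with
  | zero => simp
  | succ i ih =>
    rw [iterate_succ_apply', ih, S.conj, Homeomorph.apply_symm_apply, iterate_succ_apply']

theorem annDist_iterate_period_le {n : ℕ} {x : Annulus} (hx : x ∈ S.A n) :
    annDist x (H^[S.period n] x) ≤ S.tail n := by
  have h := S.annDist_compSeq_iterate_le le_rfl x (n := n)
  rw [S.compSeq_iterate n _ ⟨x, hx⟩, ← homeomorph_pow_apply, period, pow_orderOf_eq_one,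
    Homeomorph.one_apply, Homeomorph.symm_apply_apply] at h
  exact h

theorem annDist_symm_lt (n : ℕ) (s : unitInterval) (t : ℝ) (ht : |t| ≤ S.width n)
    (a : UnitAddCircle) :
    annDist ((S.f n).symm (s, t + a)) ((S.f n).symm (0, a)) < S.ε n := by
  obtain ⟨δ, hδ, hcont⟩ := S.width_lt n
  have h1 : annDist ((S.f n).symm (s, t + a)) ((S.f n).symm (0, t + a)) < S.ε n / 2 :=
    S.small_fibers n _ _ (by simp)
  have h2 : annDist ((S.f n).symm (0, t + a)) ((S.f n).symm (0, a)) < S.ε n / 4 := by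
    refine hcont _ _ (lt_of_le_of_lt ?_ hδ)
    simp only [annDist, dist_self, zero_add]
    rw [dist_eq_norm, add_sub_cancel_right]
    exact (norm_coe_le_abs t).trans ht
  have := annDist_triangle ((S.f n).symm (s, t + a)) ((S.f n).symm (0, t + a))
    ((S.f n).symm (0, a))
  linarith [S.ε_pos n]

/-- Rotations permute the tiles, whose images under `(f n)⁻¹` are small. The whole `H n`-orbit of
`x` is thus followed by that of a corner of its tile, which depends on `j` alone. -/
theorem exists_tile (n : ℕ) (x : S.A n) : ∃ j < S.period n, ∀ i,
    annDist ((compSeq S.g n)^[i] x)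
      ((S.f n).symm (0, (i + j) • ((S.r n : ℝ) : UnitAddCircle))) < S.ε n := by
  have hx : S.f n x ∈ ⋃ i : ℤ, ⇑(rotation (S.r n : ℝ) ^ i) '' rectangle (S.width n) := by
    rw [S.tiles_cover n]; trivial
  obtain ⟨k, z, ⟨⟨s, t⟩, ⟨-, ht⟩, rfl⟩, hz⟩ := mem_iUnion.1 hx
  have hp : (0 : ℤ) < S.period n := by exact_mod_cast S.period_pos n
  obtain ⟨j, hj⟩ := Int.eq_ofNat_of_zero_le (Int.emod_nonneg k hp.ne')
  refine ⟨j, ?_, fun i => ?_⟩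
  · have := Int.emod_lt_of_pos k hp
    omega
  rw [← zpow_mod_orderOf, show k % (orderOf (rotation (S.r n : ℝ)) : ℤ) = j from hj,
    zpow_natCast, homeomorph_pow_apply] at hz
  rw [S.compSeq_iterate, ← hz, ← iterate_add_apply, rotation_iterate]
  exact S.annDist_symm_lt n s t (by rw [abs_of_nonneg ht.1]; exact ht.2) _

theorem exists_orbit_code (n : ℕ) : ∃ J : Annulus → ℕ, (∀ x, J x < S.period n) ∧
    ∀ x ∈ S.A n, ∀ y ∈ S.A n, J x = J y → ∀ i ≤ S.period n,
      annDist (H^[i] x) (H^[i] y) ≤ 2 * S.ε n + 2 * S.tail n := by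
  classical
  -- The value `0` off `A n` only keeps the code below the period.
  refine ⟨fun x => if hx : x ∈ S.A n then (S.exists_tile n ⟨x, hx⟩).choose else 0, ?_, ?_⟩
  · intro x
    by_cases hx : x ∈ S.A n
    · simp only [dif_pos hx]
      exact (S.exists_tile n ⟨x, hx⟩).choose_spec.1
    · simp only [dif_neg hx]
      exact S.period_pos n
  · intro x hx y hy hxy i hi
    simp only [dif_pos hx, dif_pos hy] at hxy
    have h1 := (S.exists_tile n ⟨x, hx⟩).choose_spec.2 i
    have h2 := (S.exists_tile n ⟨y, hy⟩).choose_spec.2 i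
    rw [← hxy, annDist_comm] at h2
    have h3 := S.annDist_compSeq_iterate_le hi x
    have h4 := S.annDist_compSeq_iterate_le hi y
    rw [annDist_comm] at h3
    have := annDist_triangle (H^[i] x) ((compSeq S.g n)^[i] x) (H^[i] y)
    have := annDist_triangle ((compSeq S.g n)^[i] x) _ (H^[i] y) |>.trans
      (add_le_add h1.le (annDist_triangle _ ((compSeq S.g n)^[i] y) _))
    linarith

theorem exists_small_stage {e : ℝ} (he : 0 < e) (m : ℕ) :
    ∃ n ≥ m, 2 * S.ε n + 2 * S.tail n < e := by
  have h : Tendsto (fun n => 2 * S.ε n + 2 * S.tail n) atTop (𝓝 (2 * 0 + 2 * 0)) :=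
    (S.ε_summable.tendsto_atTop_zero.const_mul 2).add (S.tendsto_tail.const_mul 2)
  obtain ⟨n, hn, hm⟩ := ((h.eventually_lt_const (by simpa using he)).and
    (eventually_ge_atTop m)).exists
  exact ⟨n, hm, hn⟩

theorem attractor_subset (n : ℕ) : S.attractor ⊆ S.A n := iInter_subset _ n

theorem nonempty_attractor : S.attractor.Nonempty := by
  refine IsCompact.nonempty_iInter_of_sequence_nonempty_isCompact_isClosed S.A S.A_anti
    (fun n => ⟨_, ((S.f n).symm 0).2⟩) (S.isClosed_A 0).isCompact S.isClosed_A

theorem isPreconnected_A (n : ℕ) : IsPreconnected (S.A n) := by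
  rw [isPreconnected_iff_preconnectedSpace]
  have : PreconnectedSpace Annulus := inferInstance
  exact (S.f n).symm.surjective.denseRange.preconnectedSpace (S.f n).symm.continuous

theorem iterate_mem_attractor {x : Annulus} (hx : x ∈ S.attractor) (i : ℕ) :
    H^[i] x ∈ S.attractor := by
  induction i with
  | zero => exact hx
  | succ i ih => rwa [iterate_succ_apply', S.mem_attractor_iff]

end HAKScheme

/-! ### Displacement of a lift -/

theorem isQuotientMap_cov : IsQuotientMap cov :=
  (IsOpenMap.id.prodMap (QuotientAddGroup.isOpenMap_coe (G := ℝ))).isQuotientMap continuous_cov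
    (surjective_id.prodMap Quotient.mk_surjective)

namespace Lift

variable {H : Annulus ≃ₜ Annulus} (L : Lift H)

theorem continuous_iterate (i : ℕ) : Continuous L.toHomeo^[i] := L.toHomeo.continuous.iterate i

theorem cov_iterate (i : ℕ) (x : Strip) : cov (L.toHomeo^[i] x) = H^[i] (cov x) := by
  induction i with
  | zero => rfl
  | succ i ih => rw [iterate_succ_apply', iterate_succ_apply', L.cov_apply, ih]

theorem iterate_translate (i : ℕ) (n : ℤ) (x : Strip) :
    L.toHomeo^[i] (x.1, x.2 + n) = ((L.toHomeo^[i] x).1, (L.toHomeo^[i] x).2 + n) := by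
  induction i with
  | zero => rfl
  | succ i ih =>
    rw [iterate_succ_apply', iterate_succ_apply', ih, L.map_translate_int]

/-- The angular displacement of a point of the strip after `i` steps. -/
def disp (i : ℕ) (x : Strip) : ℝ := (L.toHomeo^[i] x).2 - x.2

theorem disp_add (i j : ℕ) (x : Strip) :
    L.disp (i + j) x = L.disp i (L.toHomeo^[j] x) + L.disp j x := by
  simp only [disp, iterate_add_apply]
  ring

/-- Displacement is invariant under deck translations, so it descends to the compact annulus; this
gives both bounds and intermediate values. -/
theorem exists_continuous_disp (i : ℕ) :
    ∃ D : Annulus → ℝ, Continuous D ∧ ∀ x, D (cov x) = L.disp i x := by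
  have key : ∀ x y : Strip, cov x = cov y → L.disp i x = L.disp i y := by
    intro x y hxy
    obtain ⟨n, hn⟩ := AddCircle.coe_eq_zero_iff (p := (1 : ℝ)).1
      (show ((x.2 - y.2 : ℝ) : UnitAddCircle) = 0 by
        rw [AddCircle.coe_sub, show (x.2 : UnitAddCircle) = y.2 from congrArg Prod.snd hxy,
          sub_self])
    rw [zsmul_eq_mul, mul_one] at hn
    have hx : x = (y.1, y.2 + n) :=
      Prod.ext (Prod.ext_iff.1 hxy).1 (show x.2 = y.2 + n by linarith)
    rw [hx]
    simp only [disp, L.iterate_translate]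
    ring
  refine ⟨fun a => L.disp i (surjInv isQuotientMap_cov.surjective a), ?_, fun x => ?_⟩
  · refine isQuotientMap_cov.continuous_iff.2 ?_
    have : (fun a => L.disp i (surjInv isQuotientMap_cov.surjective a)) ∘ cov = L.disp i :=
      funext fun x => key _ _ (surjInv_eq _ _)
    rw [this]
    exact (continuous_snd.comp (L.continuous_iterate i)).sub continuous_snd
  · exact key _ _ (surjInv_eq _ _)

theorem exists_disp_bound : ∃ B : ℝ, 0 ≤ B ∧ ∀ i x, |L.disp i x| ≤ i * B := by
  obtain ⟨D, hD, hDx⟩ := L.exists_continuous_disp 1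
  obtain ⟨B, hB⟩ := (isCompact_range hD).isBounded.exists_norm_le
  have hB1 : ∀ x, |L.disp 1 x| ≤ B := fun x => by
    rw [← hDx]
    exact hB _ (mem_range_self _)
  refine ⟨B, (abs_nonneg _).trans (hB1 (0, 0)), fun i => ?_⟩
  induction i with
  | zero => simp [disp]
  | succ i ih =>
    intro x
    rw [disp_add]
    have h1 := abs_add_le (L.disp i (L.toHomeo^[1] x)) (L.disp 1 x)
    have h2 := ih (L.toHomeo^[1] x)
    have h3 := hB1 x
    push_cast
    linarith

/-! ### Uniform convergence of the average displacement over the attractor. -/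

variable (S : HAKScheme H)

theorem abs_disp_sub_round_le (i : ℕ) (x : Strip) :
    |L.disp i x - round (L.disp i x)| ≤ annDist (cov x) (H^[i] (cov x)) := by
  rw [← UnitAddCircle.norm_eq, ← L.cov_iterate, annDist_comm]
  simp only [annDist, cov, dist_eq_norm (E := UnitAddCircle), ← AddCircle.coe_sub]
  exact le_add_of_nonneg_left dist_nonneg

theorem exists_int_disp {n : ℕ} (hn : S.tail n < 1 / 2) :
    ∃ k : ℤ, ∀ x, cov x ∈ S.A n → |L.disp (S.period n) x - k| ≤ S.tail n := by
  obtain ⟨D, hD, hDx⟩ := L.exists_continuous_disp (S.period n)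
  have hclose : ∀ a ∈ S.A n, |D a - round (D a)| ≤ S.tail n := by
    intro a ha
    obtain ⟨x, rfl⟩ := isQuotientMap_cov.surjective a
    rw [hDx]
    exact (L.abs_disp_sub_round_le _ x).trans (S.annDist_iterate_period_le ha)
  have hord := ((S.isPreconnected_A n).image D hD.continuousOn).ordConnected
  have hle : ∀ a ∈ S.A n, ∀ b ∈ S.A n, round (D b) ≤ round (D a) := by
    intro a ha b hb
    by_contra! hlt
    have h1 := abs_le.1 (hclose a ha)
    have h2 := abs_le.1 (hclose b hb)
    have hlt' : (round (D a) : ℝ) + 1 ≤ round (D b) := by exact_mod_cast hlt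
    -- If the nearest integer changed on the connected set `A n`, the displacement would take a
    -- half-integer value, at distance at least `1/2` from all integers.
    obtain ⟨c, hc, hcD⟩ := hord.out (mem_image_of_mem D ha) (mem_image_of_mem D hb)
      (show (round (D a) : ℝ) + 1 / 2 ∈ Icc (D a) (D b) from ⟨by linarith, by linarith⟩)
    have h3 := hclose c hc
    have h4 : (1 : ℝ) / 2 ≤ |D c - round (D c)| := by
      rw [hcD, le_abs]
      generalize round ((round (D a) : ℝ) + 1 / 2) = m
      rcases le_or_gt m (round (D a)) with hm | hm
      · left
        have : (m : ℝ) ≤ round (D a) := by exact_mod_cast hm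
        linarith
      · right
        have : (round (D a) : ℝ) + 1 ≤ m := by exact_mod_cast hm
        linarith
    linarith
  obtain ⟨a, ha⟩ : (S.A n).Nonempty := ⟨_, ((S.f n).symm 0).2⟩
  refine ⟨round (D a), fun x hx => ?_⟩
  rw [← hDx, le_antisymm (hle _ hx a ha) (hle a ha _ hx)]
  exact hclose _ hx

variable {L S} {α : ℝ}

/-- Every period contributes the same integer `k` up to `tail n`. The average over many periods
tends to `α * period n`, which is therefore within `tail n` of `k`; the other `tail n` is the error
of the single period. -/
theorem HasRotationNumber.abs_disp_period_sub_le (hrot : L.HasRotationNumber S.attractor α) {n : ℕ}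
    (hn : S.tail n < 1 / 2) {x : Strip} (hx : cov x ∈ S.attractor) :
    |L.disp (S.period n) x - α * S.period n| ≤ 2 * S.tail n := by
  obtain ⟨k, hk⟩ := L.exists_int_disp S hn
  have hp : (0 : ℝ) < S.period n := by exact_mod_cast S.period_pos n
  have hmul : ∀ j : ℕ, |L.disp (j * S.period n) x - j * k| ≤ j * S.tail n := by
    intro j
    induction j with
    | zero => simp [disp]
    | succ j ih =>
      rw [Nat.succ_mul, add_comm (j * _), disp_add]
      have h1 := hk (L.toHomeo^[j * S.period n] x) (by
        rw [L.cov_iterate]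
        exact S.attractor_subset n (S.iterate_mem_attractor hx _))
      rw [abs_le] at h1 ih ⊢
      push_cast
      constructor <;> linarith [h1.1, h1.2, ih.1, ih.2]
  have hlim : Tendsto (fun j : ℕ => |L.disp (j * S.period n) x / (j * S.period n : ℕ) * S.period n
      - k|) atTop (𝓝 |α * S.period n - k|) := by
    have h1 := (hrot x hx).comp (tendsto_id.atTop_mul_const' (S.period_pos n))
    exact ((h1.mul_const _).sub_const _).abs
  have hle : |α * S.period n - k| ≤ S.tail n := by
    refine le_of_tendsto hlim ?_
    filter_upwards [eventually_gt_atTop 0] with j hj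
    have hj' : (0 : ℝ) < j := by exact_mod_cast hj
    have h1 := hmul j
    have e : L.disp (j * S.period n) x / (j * S.period n : ℕ) * S.period n - k =
        (L.disp (j * S.period n) x - j * k) / j := by
      push_cast
      field_simp
    rw [e, abs_div, abs_of_pos hj', div_le_iff₀ hj']
    linarith
  have h2 := hk x (S.attractor_subset n hx)
  rw [abs_le] at h2 hle ⊢
  constructor <;> linarith [h2.1, h2.2, hle.1, hle.2]

theorem HasRotationNumber.exists_abs_disp_sub_le (hrot : L.HasRotationNumber S.attractor α) {η : ℝ}
    (hη : 0 < η) : ∃ B : ℝ, ∀ (N : ℕ) (x : Strip), cov x ∈ S.attractor →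
      |L.disp N x - α * N| ≤ η * N + B := by
  obtain ⟨n, -, hn⟩ := S.exists_small_stage (lt_min hη one_pos) 0
  have hεn := S.ε_pos n
  have hn1 : S.tail n < 1 / 2 := by linarith [min_le_right η 1]
  have hn2 : 2 * S.tail n ≤ η := by linarith [min_le_left η 1]
  obtain ⟨B, hB0, hB⟩ := L.exists_disp_bound
  have hp := S.period_pos n
  set p := S.period n with hpdef
  refine ⟨p * (B + |α|), fun N x hx => ?_⟩
  have hmul : ∀ j : ℕ, |L.disp (p * j) x - α * (p * j : ℕ)| ≤ η * j := by
    intro j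
    induction j with
    | zero => simp [disp]
    | succ j ih =>
      rw [Nat.mul_succ, add_comm, disp_add]
      have h1 := hrot.abs_disp_period_sub_le hn1 (x := L.toHomeo^[p * j] x) (by
        rw [L.cov_iterate]
        exact S.iterate_mem_attractor hx _)
      rw [← hpdef] at h1
      rw [abs_le] at h1 ih ⊢
      push_cast at *
      constructor <;> linarith [h1.1, h1.2, ih.1, ih.2]
  -- Full periods cost at most `η` each; the remainder, shorter than `p`, goes into the constant.
  have hN : N = N % p + p * (N / p) := (Nat.mod_add_div N p).symm
  have hmod : ((N % p : ℕ) : ℝ) ≤ p := by exact_mod_cast (Nat.mod_lt N hp).le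
  have hdiv : ((N / p : ℕ) : ℝ) ≤ N := by exact_mod_cast Nat.div_le_self N p
  have h1 := hB (N % p) (L.toHomeo^[p * (N / p)] x)
  have h2 := hmul (N / p)
  have h3 : |α * (N % p : ℕ)| ≤ p * |α| := by
    rw [abs_mul, Nat.abs_cast, mul_comm]
    gcongr
  have h4 : ((N % p : ℕ) : ℝ) * B ≤ p * B := by gcongr
  have h5 : η * (N / p : ℕ) ≤ η * N := by gcongr
  have e : L.disp N x - α * N = L.disp (N % p) (L.toHomeo^[p * (N / p)] x) +
      (L.disp (p * (N / p)) x - α * (p * (N / p) : ℕ)) - α * (N % p : ℕ) := by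
    have e1 : L.disp N x = _ := (congrArg (fun m => L.disp m x) hN).trans (L.disp_add _ _ x)
    have e2 : (N : ℝ) = (N % p : ℕ) + (p * (N / p) : ℕ) := by exact_mod_cast hN
    rw [e1]
    linear_combination (-α) * e2
  rw [e]
  rw [abs_le] at *
  constructor <;> linarith [h1.1, h1.2, h2.1, h2.2, h3.1, h3.2]

end Lift

/-! ### Fibres of the suspension -/

section Fibres

open Dynamics Uniformity

variable {C : Type*} [MetricSpace C] (h : C ≃ₜ C)

theorem quot_shift (n : ℤ) (x : Strip) (c : C) :
    quot h (x, c) = quot h ((x.1, x.2 - n), (h ^ n) c) := by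
  have := quot_translate h (-n) (x, c)
  rw [neg_neg] at this
  rw [← this]
  push_cast
  rfl

variable {H : Annulus ≃ₜ Annulus} (L : Lift H)

theorem suspHomeo_iterate (i : ℕ) (x : Strip) (c : C) :
    (suspHomeo h L)^[i] (quot h (x, c)) = quot h (L.toHomeo^[i] x, c) := by
  induction i with
  | zero => rfl
  | succ i ih => rw [iterate_succ_apply', iterate_succ_apply', ih, suspHomeo_quot]

variable [CompactSpace C]

/-- Translating by the integer part of `x.2` puts `x` over `[0,1)` and a point less than `1` away
over `[-1,2]`, where compactness makes `quot` uniformly continuous. -/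
theorem exists_dist_quot_mem {W : SetRel (SuspSpace h) (SuspSpace h)}
    (hW : W ∈ 𝓤 (SuspSpace h)) : ∃ δ > 0, ∀ (x y : Strip) (a b : C), dist x y < δ →
      dist ((h ^ ⌊x.2⌋) a) ((h ^ ⌊x.2⌋) b) < δ → (quot h (x, a), quot h (y, b)) ∈ W := by
  have hK : IsCompact (((univ : Set unitInterval) ×ˢ Icc (-1 : ℝ) 2) ×ˢ (univ : Set C)) :=
    (isCompact_univ.prod isCompact_Icc).prod isCompact_univ
  have hu := hK.uniformContinuousOn_of_continuous (isQuotientMap_quot h).continuous.continuousOn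
  have hu' := hu hW
  rw [mem_map, mem_inf_principal, Metric.mem_uniformity_dist] at hu'
  obtain ⟨δ, hδ, H⟩ := hu'
  refine ⟨min δ 1, lt_min hδ one_pos, fun x y a b hxy hab => ?_⟩
  rw [quot_shift h ⌊x.2⌋ x a, quot_shift h ⌊x.2⌋ y b]
  obtain ⟨h1, h2⟩ := lt_min_iff.1 hxy
  have hd : dist (x.1, x.2 - (⌊x.2⌋ : ℝ)) (y.1, y.2 - (⌊x.2⌋ : ℝ)) = dist x y := by
    simp [Prod.dist_eq]
  have hx0 := Int.floor_le x.2
  have hx1 := Int.lt_floor_add_one x.2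
  have h3 : |x.2 - y.2| < 1 := by
    rw [← Real.dist_eq]
    exact (le_max_right _ _).trans_lt h2
  rw [abs_lt] at h3
  refine H ?_ ⟨⟨⟨trivial, ?_, ?_⟩, trivial⟩, ⟨⟨trivial, ?_, ?_⟩, trivial⟩⟩
  · rw [Prod.dist_eq]
    exact max_lt (by rw [hd]; exact h1) (hab.trans_le (min_le_left _ _))
  all_goals dsimp only; linarith [h3.1, h3.2]

/-- Over one strip point the quotient map is injective in the fibre. Pairs at fibre distance at
least `δ` over `[0,1]` thus have a compact image off the diagonal, and `W` is its complement. -/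
theorem exists_dist_lt_of_quot_mem {δ : ℝ} (hδ : 0 < δ) : ∃ W ∈ 𝓤 (SuspSpace h),
    ∀ (x : Strip) (a b : C), (quot h (x, a), quot h (x, b)) ∈ W →
      dist ((h ^ ⌊x.2⌋) a) ((h ^ ⌊x.2⌋) b) < δ := by
  let φ : Strip × (C × C) → SuspSpace h × SuspSpace h := fun p =>
    (quot h (p.1, p.2.1), quot h (p.1, p.2.2))
  have hφ : Continuous φ := by
    have := (isQuotientMap_quot h).continuous
    fun_prop
  have hK : IsCompact (((univ : Set unitInterval) ×ˢ Icc (0 : ℝ) 1) ×ˢ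
      {p : C × C | δ ≤ dist p.1 p.2}) :=
    (isCompact_univ.prod isCompact_Icc).prod
      (isClosed_le continuous_const continuous_dist).isCompact
  refine ⟨(φ '' ((univ ×ˢ Icc 0 1) ×ˢ {p | δ ≤ dist p.1 p.2}))ᶜ, ?_, fun x a b hab => ?_⟩
  · rw [← nhdsSet_diagonal_eq_uniformity]
    refine (hK.image hφ).isClosed.isOpen_compl.mem_nhdsSet.2 ?_
    rintro ⟨z, w⟩ hzw ⟨⟨x, a, b⟩, ⟨-, hp⟩, he⟩
    have hzw' : z = w := hzw
    have h1 : quot h (x, a) = quot h (x, b) :=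
      (congrArg Prod.fst he).trans (hzw'.trans (congrArg Prod.snd he).symm)
    obtain ⟨-, n, hn, hc⟩ := (quot_eq_iff h _ _).1 h1
    have hn0 : n = 0 := by
      have : (n : ℝ) = 0 := by
        dsimp only at hn
        linarith
      exact_mod_cast this
    have hba : b = a := by simpa [hn0] using hc
    have hp' : δ ≤ dist a b := hp
    rw [hba, dist_self] at hp'
    linarith
  · by_contra! hlt
    refine hab ⟨((x.1, x.2 - ⌊x.2⌋), ((h ^ ⌊x.2⌋) a, (h ^ ⌊x.2⌋) b)), ⟨⟨trivial, ?_, ?_⟩, hlt⟩, ?_⟩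
    · exact sub_nonneg.2 (Int.floor_le _)
    · dsimp only
      linarith [Int.lt_floor_add_one x.2]
    · rw [quot_shift h ⌊x.2⌋ x a, quot_shift h ⌊x.2⌋ x b]

theorem exists_dist_zpow_lt (n : ℕ) {δ : ℝ} (hδ : 0 < δ) : ∃ δ' > 0, ∀ a b : C, dist a b < δ' →
    ∀ j : ℤ, |j| ≤ n → dist ((h ^ j) a) ((h ^ j) b) < δ := by
  have h1 : ∀ j : ℤ, ∃ δ' > 0, ∀ a b : C, dist a b < δ' → dist ((h ^ j) a) ((h ^ j) b) < δ :=
    fun j => by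
      obtain ⟨δ', hδ', H⟩ := Metric.uniformContinuous_iff.1
        (CompactSpace.uniformContinuous_of_continuous (h ^ j).continuous) δ hδ
      exact ⟨δ', hδ', fun a b hab => H hab⟩
  choose d hd hd' using h1
  have hne : (Finset.Icc (-(n : ℤ)) n).Nonempty := ⟨0, by simp⟩
  refine ⟨(Finset.Icc (-(n : ℤ)) n).inf' hne d, (Finset.lt_inf'_iff hne).2 fun j _ => hd j,
    fun a b hab j hj => hd' j a b (hab.trans_le (Finset.inf'_le _ ?_))⟩
  exact Finset.mem_Icc.2 (abs_le.1 hj)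

/-! ### Integer levels met by an orbit: a discrete intermediate value theorem. -/

theorem exists_abs_sub_le_of_steps {k : ℕ → ℤ} {B : ℤ} (hB : 0 ≤ B)
    (hk : ∀ i, |k (i + 1) - k i| ≤ B) {m : ℤ} (h0 : k 0 ≤ m) {N : ℕ} (hN : m ≤ k N) :
    ∃ i ≤ N, |m - k i| ≤ B := by
  induction N with
  | zero => exact ⟨0, le_rfl, by rw [le_antisymm hN h0]; simpa⟩
  | succ N ih =>
    rcases le_or_gt m (k N) with h1 | h1
    · obtain ⟨i, hi, hi'⟩ := ih h1
      exact ⟨i, hi.trans (Nat.le_succ N), hi'⟩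
    · refine ⟨N, Nat.le_succ N, ?_⟩
      have := abs_le.1 (hk N)
      rw [abs_le]
      constructor <;> linarith [this.1, this.2]

theorem exists_window {k : ℕ → ℤ} {B : ℤ} (hB : 0 ≤ B) (hk : ∀ i, |k (i + 1) - k i| ≤ B)
    {n : ℤ} {N : ℕ} (hn : n ≤ |k N - k 0|) :
    ∃ K : ℤ, ∀ m, K ≤ m → m ≤ K + n → ∃ i ≤ N, |m - k i| ≤ B := by
  rcases le_or_gt 0 (k N - k 0) with h | h
  · rw [abs_of_nonneg h] at hn
    exact ⟨k 0, fun m h1 h2 => exists_abs_sub_le_of_steps hB hk h1 (by linarith)⟩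
  · rw [abs_of_neg h] at hn
    refine ⟨k 0 - n, fun m h1 h2 => ?_⟩
    obtain ⟨i, hi, hi'⟩ := exists_abs_sub_le_of_steps (k := fun i => -k i) (m := -m) hB
      (fun i => by rw [← abs_neg]; convert hk i using 2; ring) (N := N)
      (by linarith) (by linarith)
    refine ⟨i, hi, ?_⟩
    rw [← abs_neg]
    convert hi' using 2
    ring

/-! ### The lower bound for the entropy. -/

variable {L} {S : HAKScheme H} {α : ℝ}

theorem exists_cover_fibre_of_cover (hrot : L.HasRotationNumber S.attractor α) {δ η : ℝ}
    (hδ : 0 < δ) (hη : 0 < η) : ∃ W ∈ 𝓤 (SuspSpace h), ∃ B : ℝ, ∀ (N n : ℕ),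
      (n : ℝ) ≤ (|α| - η) * N - B → ∀ s : Finset (SuspSpace h),
        IsDynCoverOf (suspHomeo h L) (pseudoSusp h S.attractor) W (N + 1) s →
        ∃ t : Finset C, IsDynCoverOf h univ {p | dist p.1 p.2 < δ} n t ∧ t.card ≤ s.card := by
  obtain ⟨a, ha⟩ := S.nonempty_attractor
  obtain ⟨x, rfl⟩ := isQuotientMap_cov.surjective a
  obtain ⟨B, hB0, hB⟩ := L.exists_disp_bound
  obtain ⟨B', hB'⟩ := hrot.exists_abs_disp_sub_le hη
  let k : ℕ → ℤ := fun i => ⌊(L.toHomeo^[i] x).2⌋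
  have hk : ∀ i, |k (i + 1) - k i| ≤ ((⌈B⌉₊ + 1 : ℕ) : ℤ) := by
    intro i
    have h1 := hB 1 (L.toHomeo^[i] x)
    rw [Lift.disp, ← iterate_add_apply, add_comm 1 i, Nat.cast_one, one_mul] at h1
    have h2 := Nat.le_ceil B
    have h3 : |((k (i + 1) - k i : ℤ) : ℝ)| < ((⌈B⌉₊ + 1 : ℕ) : ℝ) := by
      have a1 := Int.floor_le (L.toHomeo^[i] x).2
      have a2 := Int.lt_floor_add_one (L.toHomeo^[i] x).2
      have b1 := Int.floor_le (L.toHomeo^[i + 1] x).2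
      have b2 := Int.lt_floor_add_one (L.toHomeo^[i + 1] x).2
      rw [abs_le] at h1
      push_cast
      rw [abs_lt]
      constructor <;> linarith [h1.1, h1.2]
    exact_mod_cast h3.le
  -- The orbit may jump over a level `m`, but passes within `⌈B⌉₊ + 1` of it; closeness at the
  -- visited level must survive that many applications of `h` or its inverse.
  obtain ⟨δ', hδ', hshift⟩ := exists_dist_zpow_lt h (⌈B⌉₊ + 1) hδ
  obtain ⟨W, hW, hWdist⟩ := exists_dist_lt_of_quot_mem h hδ'
  obtain ⟨V, hV, hVsymm, hVW⟩ := comp_symm_mem_uniformity_sets hW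
  refine ⟨V, hV, B' + 1, fun N n hn s hs => ?_⟩
  have hwin : (n : ℤ) ≤ |k N - k 0| := by
    have h1 := hB' N x ha
    have h2 : |α| * N ≤ |L.disp N x| + (η * N + B') := by
      have := abs_sub_abs_le_abs_sub (α * N) (L.disp N x)
      rw [abs_mul, Nat.abs_cast, abs_sub_comm] at this
      linarith
    have h3 : |L.disp N x| ≤ |((k N - k 0 : ℤ) : ℝ)| + 1 := by
      have a1 : (k 0 : ℝ) ≤ x.2 := Int.floor_le x.2
      have a2 : x.2 < k 0 + 1 := Int.lt_floor_add_one x.2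
      have b1 : (k N : ℝ) ≤ (L.toHomeo^[N] x).2 := Int.floor_le _
      have b2 : (L.toHomeo^[N] x).2 < k N + 1 := Int.lt_floor_add_one _
      have e : |L.disp N x - ((k N - k 0 : ℤ) : ℝ)| ≤ 1 := by
        rw [Lift.disp, abs_le]
        push_cast
        constructor <;> linarith
      have := abs_sub_abs_le_abs_sub (L.disp N x) ((k N - k 0 : ℤ) : ℝ)
      linarith
    have h4 : (n : ℝ) ≤ |((k N - k 0 : ℤ) : ℝ)| := by linarith
    exact_mod_cast h4
  obtain ⟨K, hK⟩ := exists_window (by positivity) hk hwin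
  -- Starting from `(h ^ (-K)) c` turns the levels from `K` on into the times `0, 1, …` of the
  -- `h`-orbit of `c`, whatever the sign of `α`.
  refine exists_isDynCoverOf_of_small s
    (fun z => {c | (quot h (x, (h ^ (-K)) c), z) ∈ dynEntourage (suspHomeo h L) V (N + 1)})
    (fun c _ => hs (show quot h (x, (h ^ (-K)) c) ∈ pseudoSusp h S.attractor from ha)) ?_
  intro z _ c hc c' hc'
  rw [mem_dynEntourage]
  intro m hm
  obtain ⟨i, hi, him⟩ := hK (K + m) (by linarith) (by
    have : (m : ℤ) < n := by exact_mod_cast hm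
    linarith)
  have h1 := mem_dynEntourage.1 hc i (Nat.lt_succ_of_le hi)
  have h2 := mem_dynEntourage.1 hc' i (Nat.lt_succ_of_le hi)
  rw [suspHomeo_iterate] at h1 h2
  have h3 := hWdist _ _ _ (hVW ⟨_, h1, hVsymm.symm _ _ h2⟩)
  have h4 := hshift _ _ h3 _ him
  have e : ∀ c : C, (h ^ (K + (m : ℤ) - k i)) ((h ^ k i) ((h ^ (-K)) c)) = h^[m] c := by
    intro c
    rw [← Homeomorph.mul_apply, ← Homeomorph.mul_apply, ← zpow_add, ← zpow_add,
      ← homeomorph_pow_apply, ← zpow_natCast]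
    congr 2
    ring
  change dist ((h ^ (K + (m : ℤ) - k i)) ((h ^ k i) ((h ^ (-K)) c)))
    ((h ^ (K + (m : ℤ) - k i)) ((h ^ k i) ((h ^ (-K)) c'))) < δ at h4
  rw [e, e] at h4
  exact h4

theorem coverEntropy_fibre_le (hα : α ≠ 0) (hrot : L.HasRotationNumber S.attractor α) {c : ℝ}
    (hc0 : 0 ≤ c)
    (hc : coverEntropy (suspHomeo h L) (pseudoSusp h S.attractor) ≤ (c : EReal)) :
    coverEntropy h univ ≤ ((c / |α| : ℝ) : EReal) := by
  have hα' : 0 < |α| := abs_pos.2 hα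
  refine coverEntropy_le_of_exists_isDynCoverOf (mapsTo_univ _ _) fun U hU c' hc' => ?_
  obtain ⟨δ, hδ, hδU⟩ := Metric.mem_uniformity_dist.1 hU
  have hc'0 : 0 < c' := (div_nonneg hc0 hα'.le).trans_lt hc'
  have hg : 0 < c' * |α| - c := by
    rw [gt_iff_lt, div_lt_iff₀ hα'] at hc'
    linarith
  obtain ⟨g, hgdef⟩ : ∃ g, g = c' * |α| - c := ⟨_, rfl⟩
  rw [← hgdef] at hg
  -- With this loss of speed, `c'` times the number of `h`-steps is about `(c + 2 * g / 3) * N`.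
  -- That leaves `g / 3` per step over the cover's rate `c + g / 3` to absorb the constants.
  have hη : 0 < g / (3 * c') := by positivity
  have hηc : c' * (g / (3 * c')) = g / 3 := by field_simp
  obtain ⟨W, hW, B, hcov⟩ := exists_cover_fibre_of_cover h hrot hδ hη
  have hslope : 0 < |α| - g / (3 * c') := by
    have : 0 < c' * (|α| - g / (3 * c')) := by
      rw [mul_sub, hηc]
      linarith
    exact pos_of_mul_pos_right this hc'0.le
  have ev1 := eventually_exists_isDynCoverOf hc hW (show c < c + g / 3 by linarith)
  have ev1' := (tendsto_add_atTop_nat 1).eventually ev1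
  have ev2 := (tendsto_natCast_atTop_atTop (R := ℝ)).const_mul_atTop hslope |>.eventually_ge_atTop
    (B + 1)
  have ev3 := (tendsto_natCast_atTop_atTop (R := ℝ)).const_mul_atTop
    (show 0 < g / 3 by linarith) |>.eventually_ge_atTop (c + g / 3 + c' * (B + 1))
  obtain ⟨N, ⟨s, hs, hscard⟩, hN2, hN3⟩ := (ev1'.and (ev2.and ev3)).exists
  have hn0 : 0 ≤ (|α| - g / (3 * c')) * N - B := by linarith
  obtain ⟨t, ht, htcard⟩ := hcov N ⌊(|α| - g / (3 * c')) * N - B⌋₊ (Nat.floor_le hn0) s hs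
  refine ⟨_, ?_, t, ht.of_entourage_subset (fun p hp => hδU hp), ?_⟩
  · exact (Nat.floor_pos.2 (by linarith)).ne'
  · have h1 : (t.card : ℝ) ≤ s.card := by exact_mod_cast htcard
    refine h1.trans (hscard.trans (Real.exp_le_exp.2 ?_))
    have h2 := (Nat.lt_floor_add_one ((|α| - g / (3 * c')) * N - B)).le
    have h3 := mul_le_mul_of_nonneg_left h2 hc'0.le
    have h4 : c' * ((|α| - g / (3 * c')) * N - B) = (c + 2 * (g / 3)) * N - c' * B := by
      have : c' * |α| = g + c := by linarith
      linear_combination (N : ℝ) * this - (N : ℝ) * hηc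
    push_cast
    linarith

end Fibres

/-! ### Orbit codes -/

section Codes

variable {H : Annulus ≃ₜ Annulus}

namespace HAKScheme

variable (S : HAKScheme H)

/-- The return error after the constant period is at most `tail n` for all large `n`, hence zero. -/
theorem iterate_eq_iterate_mod_of_period_const {n₁ : ℕ} (hn₁ : ∀ n ≥ n₁, S.period n = S.period n₁)
    {x : Annulus} (hx : x ∈ S.attractor) (i : ℕ) : H^[i] x = H^[i % S.period n₁] x := by
  have hfix : ∀ y ∈ S.attractor, H^[S.period n₁] y = y := by
    intro y hy
    have h1 : annDist y (H^[S.period n₁] y) ≤ 0 := by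
      refine ge_of_tendsto S.tendsto_tail ?_
      filter_upwards [eventually_ge_atTop n₁] with n hn
      rw [← hn₁ n hn]
      exact S.annDist_iterate_period_le (S.attractor_subset n hy)
    exact (dist_le_zero.1 ((dist_le_annDist _ _).trans h1)).symm
  conv_lhs => rw [← Nat.mod_add_div i (S.period n₁), iterate_add_apply, iterate_mul]
  congr 1
  generalize i / S.period n₁ = j
  induction j with
  | zero => rfl
  | succ j ih => rw [iterate_succ_apply, hfix x hx, ih]

theorem exists_annulus_code {e η : ℝ} (he : 0 < e) (hη : 0 < η) (N₀ : ℕ) :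
    ∃ N ≥ N₀, ∃ (J : Annulus → ℕ) (M : ℕ), (∀ x, J x < M) ∧ 2 * (M : ℝ) ≤ Real.exp (η * N) ∧
      ∀ x ∈ S.attractor, ∀ y ∈ S.attractor, J x = J y → ∀ i ≤ N,
        annDist (H^[i] x) (H^[i] y) < e := by
  have hexp : ∀ᶠ N : ℕ in atTop, 2 * (N : ℝ) ≤ Real.exp (η * N) := by
    have h1 := (Real.tendsto_exp_div_pow_atTop 1).comp
      ((tendsto_natCast_atTop_atTop (R := ℝ)).const_mul_atTop hη)
    filter_upwards [h1.eventually_ge_atTop (2 / η), eventually_gt_atTop 0] with N hN hN0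
    have hN0' : (0 : ℝ) < N := by exact_mod_cast hN0
    rw [comp_apply, pow_one, le_div_iff₀ (by positivity)] at hN
    calc 2 * (N : ℝ) = 2 / η * (η * N) := by field_simp
      _ ≤ _ := hN
  -- Unbounded periods serve as the times `N` themselves. Bounded ones become constant, so `H` is
  -- periodic on the attractor and one finite code works for all times.
  by_cases hb : ∀ b, ∃ n, b ≤ S.period n
  · have hp : Tendsto S.period atTop atTop := tendsto_atTop_atTop_of_monotone S.period_monotone hb
    obtain ⟨m, hm⟩ := eventually_atTop.1
      ((hp.eventually hexp).and (hp.eventually_ge_atTop N₀))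
    obtain ⟨n, hnm, hn⟩ := S.exists_small_stage he m
    obtain ⟨J, hJ, hcode⟩ := S.exists_orbit_code n
    exact ⟨S.period n, (hm n hnm).2, J, S.period n, hJ, (hm n hnm).1, fun x hx y hy hxy i hi =>
      (hcode x (S.attractor_subset n hx) y (S.attractor_subset n hy) hxy i hi).trans_lt hn⟩
  · push Not at hb
    obtain ⟨b, hb⟩ := hb
    have hbdd : BddAbove (range S.period) := ⟨b, by rintro _ ⟨n, rfl⟩; exact (hb n).le⟩
    obtain ⟨n₁, hn₁⟩ := Nat.sSup_mem (range_nonempty S.period) hbdd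
    have hconst : ∀ n ≥ n₁, S.period n = S.period n₁ := fun n hn =>
      le_antisymm (hn₁ ▸ le_csSup hbdd (mem_range_self n)) (S.period_monotone hn)
    obtain ⟨n, hn, hsmall⟩ := S.exists_small_stage he n₁
    obtain ⟨J, hJ, hcode⟩ := S.exists_orbit_code n
    obtain ⟨N, hN, hN0, hNp⟩ := (hexp.and ((eventually_ge_atTop N₀).and
      (eventually_ge_atTop (S.period n)))).exists
    have hcast : (S.period n : ℝ) ≤ N := by exact_mod_cast hNp
    refine ⟨N, hN0, J, S.period n, hJ, by linarith, fun x hx y hy hxy i _ => ?_⟩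
    rw [S.iterate_eq_iterate_mod_of_period_const hconst hx,
      S.iterate_eq_iterate_mod_of_period_const hconst hy]
    refine (hcode x (S.attractor_subset n hx) y (S.attractor_subset n hy) hxy _ ?_).trans_lt hsmall
    rw [hconst n hn]
    exact (Nat.mod_lt _ (S.period_pos n₁)).le

end HAKScheme

theorem dist_le_annDist_cov {x y : Strip} (h : |x.2 - y.2| ≤ 1 / 2) :
    dist x y ≤ annDist (cov x) (cov y) := by
  refine le_trans (le_of_eq ?_) (dist_le_annDist _ _)
  rw [Prod.dist_eq, Prod.dist_eq]
  congr 1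
  simp only [cov, dist_eq_norm (E := UnitAddCircle), ← AddCircle.coe_sub]
  rw [(AddCircle.norm_coe_eq_abs_iff (1 : ℝ) one_ne_zero).2 (by simpa using h), Real.dist_eq]

namespace Lift

variable (L : Lift H)

theorem exists_dist_apply_le : ∃ δ > 0, ∀ x y : Strip, dist x y < δ →
    dist (L.toHomeo x) (L.toHomeo y) ≤ 1 / 2 := by
  have hK : IsCompact ((univ : Set unitInterval) ×ˢ Icc (-1 : ℝ) 2) :=
    isCompact_univ.prod isCompact_Icc
  have hu := hK.uniformContinuousOn_of_continuous L.toHomeo.continuous.continuousOn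
  obtain ⟨δ, hδ, hd⟩ := Metric.uniformContinuousOn_iff.1 hu (1 / 2) (by norm_num)
  refine ⟨min δ 1, lt_min hδ one_pos, fun x y hxy => ?_⟩
  obtain ⟨h1, h2⟩ := lt_min_iff.1 hxy
  have h3 : |x.2 - y.2| < 1 := by
    rw [← Real.dist_eq]
    exact (le_max_right _ _).trans_lt h2
  rw [abs_lt] at h3
  have hx0 := Int.floor_le x.2
  have hx1 := Int.lt_floor_add_one x.2
  have e : ∀ z : Strip, L.toHomeo z = ((L.toHomeo (z.1, z.2 - ⌊x.2⌋)).1,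
      (L.toHomeo (z.1, z.2 - ⌊x.2⌋)).2 + ⌊x.2⌋) := by
    intro z
    rw [← L.map_translate_int]
    simp
  have h4 := hd (x.1, x.2 - ⌊x.2⌋) ⟨trivial, by constructor <;> dsimp only <;> linarith⟩
    (y.1, y.2 - ⌊x.2⌋) ⟨trivial, by constructor <;> dsimp only <;> linarith⟩
    (by simpa [Prod.dist_eq] using h1)
  rw [e x, e y]
  rw [Prod.dist_eq] at h4 ⊢
  rw [dist_add_right]
  exact h4.le

variable (S : HAKScheme H)

/-- An extra bit records the half of `[0,1)`, so that points with equal codes start at most `1/2`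
apart in the real coordinate, where distances in the annulus control those in the strip. Closeness
below `δ'` keeps their images within `1/2`, and the comparison propagates along the orbit. -/
theorem exists_strip_code {δ η : ℝ} (hδ : 0 < δ) (hη : 0 < η) (N₀ : ℕ) :
    ∃ N ≥ N₀, ∃ (J : Strip → ℕ) (M : ℕ), (M : ℝ) ≤ Real.exp (η * N) ∧ (∀ x, J x < M) ∧
      ∀ x y : Strip, cov x ∈ S.attractor → cov y ∈ S.attractor → x.2 ∈ Ico (0 : ℝ) 1 →
        y.2 ∈ Ico (0 : ℝ) 1 → J x = J y → ∀ i ≤ N,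
        dist (L.toHomeo^[i] x) (L.toHomeo^[i] y) < δ := by
  classical
  obtain ⟨δ', hδ', hd⟩ := L.exists_dist_apply_le
  obtain ⟨N, hN, J, M, hJ, hM, hcode⟩ := S.exists_annulus_code (lt_min hδ hδ') hη N₀
  refine ⟨N, hN, fun x => 2 * J (cov x) + if x.2 < 1 / 2 then 0 else 1, 2 * M,
    by push_cast; exact hM, ?_, ?_⟩
  · intro x
    have := hJ (cov x)
    dsimp only
    split_ifs <;> omega
  · intro x y hx hy hx2 hy2 hxy
    have hJxy : J (cov x) = J (cov y) := by
      dsimp only at hxy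
      split_ifs at hxy <;> omega
    have hclose : |x.2 - y.2| ≤ 1 / 2 := by
      rw [abs_le]
      obtain ⟨h1, h2⟩ := hx2
      obtain ⟨h3, h4⟩ := hy2
      dsimp only at hxy
      split_ifs at hxy
      · constructor <;> linarith
      · omega
      · omega
      · constructor <;> linarith
    have key : ∀ i ≤ N, dist (L.toHomeo^[i] x) (L.toHomeo^[i] y) < min δ δ' := by
      intro i hi
      have hcov := hcode _ hx _ hy hJxy i hi
      rw [← L.cov_iterate, ← L.cov_iterate] at hcov
      refine (dist_le_annDist_cov ?_).trans_lt hcov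
      induction i with
      | zero => exact hclose
      | succ i ih =>
        have hi' : i ≤ N := (Nat.le_succ i).trans hi
        have hcov' := hcode _ hx _ hy hJxy i hi'
        rw [← L.cov_iterate, ← L.cov_iterate] at hcov'
        have h1 := hd _ _ (((dist_le_annDist_cov (ih hi' hcov')).trans_lt hcov').trans_le
          (min_le_right _ _))
        rw [← iterate_succ_apply' (⇑L.toHomeo), ← iterate_succ_apply' (⇑L.toHomeo), Prod.dist_eq] at h1
        rw [← Real.dist_eq]
        exact (le_max_right _ _).trans h1
    exact fun i hi => (key i hi).trans_le (min_le_left _ _)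

end Lift

end Codes

/-! ### The upper bound for the entropy -/

section UpperBound

open Dynamics Uniformity

variable {C : Type*} [MetricSpace C] (h : C ≃ₜ C) {H : Annulus ≃ₜ Annulus}
  {L : Lift H} {S : HAKScheme H} {α : ℝ}

theorem Lift.HasRotationNumber.exists_floor_window (hrot : L.HasRotationNumber S.attractor α)
    {η : ℝ} (hη : 0 < η) : ∃ B : ℝ, ∀ N : ℕ, ∃ K : ℤ, ∀ x : Strip, cov x ∈ S.attractor →
      x.2 ∈ Ico (0 : ℝ) 1 → ∀ i < N, K ≤ ⌊(L.toHomeo^[i] x).2⌋ ∧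
        (⌊(L.toHomeo^[i] x).2⌋ : ℝ) ≤ K + ((|α| + 2 * η) * N + B) := by
  obtain ⟨B, hB⟩ := hrot.exists_abs_disp_sub_le hη
  -- The minimum treats both signs of `α`. In `2 * B + 2`, one `B` comes from each end, one unit
  -- from `x.2 < 1` and one from the floor defining `K`.
  refine ⟨2 * B + 2, fun N => ⟨⌊min 0 (α * N) - η * N - B⌋, fun x hx hx2 i hi => ?_⟩⟩
  have h1 := abs_le.1 (hB i x hx)
  rw [Lift.disp] at h1
  obtain ⟨h2, h3⟩ := hx2
  have hiN : (i : ℝ) ≤ N := by exact_mod_cast hi.le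
  have hi0 : (0 : ℝ) ≤ i := Nat.cast_nonneg i
  have h4 : η * i ≤ η * N := by gcongr
  have h5 : min 0 (α * N) ≤ α * i ∧ α * i ≤ min 0 (α * N) + |α| * N := by
    rcases le_total 0 α with ha | ha
    · rw [abs_of_nonneg ha, min_eq_left (by positivity)]
      have : α * i ≤ α * N := by gcongr
      exact ⟨by positivity, by linarith⟩
    · have hm : α * N ≤ α * i := mul_le_mul_of_nonpos_left hiN ha
      have hm' : α * i ≤ 0 := mul_nonpos_of_nonpos_of_nonneg ha hi0
      rw [abs_of_nonpos ha, min_eq_right (hm.trans hm')]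
      exact ⟨hm, by linarith⟩
  constructor
  · exact Int.floor_le_floor (by linarith [h1.1, h5.1])
  · have h6 := Int.lt_floor_add_one (min 0 (α * N) - η * N - B)
    have h7 := Int.floor_le (L.toHomeo^[i] x).2
    linarith [h1.2, h5.2]

theorem exists_rep_mem_Ico (z : SuspSpace h) :
    ∃ (x : Strip) (c : C), x.2 ∈ Ico (0 : ℝ) 1 ∧ quot h (x, c) = z := by
  obtain ⟨⟨x, c⟩, rfl⟩ := (isQuotientMap_quot h).surjective z
  exact ⟨(x.1, x.2 - ⌊x.2⌋), _, ⟨sub_nonneg.2 (Int.floor_le _),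
    by dsimp only; linarith [Int.lt_floor_add_one x.2]⟩, (quot_shift h ⌊x.2⌋ x c).symm⟩

theorem mapsTo_suspHomeo_pseudoSusp (L : Lift H) (S : HAKScheme H) :
    MapsTo (suspHomeo h L) (pseudoSusp h S.attractor) (pseudoSusp h S.attractor) := by
  intro z hz
  change bundleProj h (suspHomeo h L z) ∈ S.attractor
  rw [bundleProj_suspHomeo, S.mem_attractor_iff]
  exact hz

variable [CompactSpace C]

theorem exists_cover_of_cover_fibre (hrot : L.HasRotationNumber S.attractor α)
    {W : SetRel (SuspSpace h) (SuspSpace h)} (hW : W ∈ 𝓤 (SuspSpace h)) {η : ℝ} (hη : 0 < η) :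
    ∃ V ∈ 𝓤 C, ∃ B : ℝ, ∀ N₀ : ℕ, ∃ N ≥ N₀, ∀ (l : ℕ), (|α| + 2 * η) * N + B ≤ l →
      ∀ t : Finset C, IsDynCoverOf h univ V l t → ∃ s : Finset (SuspSpace h),
        IsDynCoverOf (suspHomeo h L) (pseudoSusp h S.attractor) W N s ∧
        (s.card : ℝ) ≤ t.card * Real.exp (η * N) := by
  obtain ⟨δ, hδ, hδW⟩ := exists_dist_quot_mem h hW
  obtain ⟨B, hB⟩ := hrot.exists_floor_window hη
  refine ⟨{p | dist p.1 p.2 < δ / 2}, Metric.dist_mem_uniformity (half_pos hδ), B + 1,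
    fun N₀ => ?_⟩
  obtain ⟨N, hN, J, M, hM, hJ, hcode⟩ := L.exists_strip_code S hδ hη N₀
  obtain ⟨K, hK⟩ := hB N
  refine ⟨N, hN, fun l hl t ht => ?_⟩
  suffices hsuff : ∃ s : Finset (SuspSpace h),
      IsDynCoverOf (suspHomeo h L) (pseudoSusp h S.attractor) W N s ∧
        s.card ≤ (t ×ˢ Finset.range M).card by
    obtain ⟨s, hs, hcard⟩ := hsuff
    refine ⟨s, hs, ?_⟩
    rw [Finset.card_product, Finset.card_range] at hcard
    calc (s.card : ℝ) ≤ t.card * M := by exact_mod_cast hcard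
      _ ≤ _ := by gcongr
  -- A piece fixes the base code and the centre followed by `(h ^ K) a`. All levels met before time
  -- `N` have the form `K + m` with `m < l`, so the fibres stay close too.
  refine exists_isDynCoverOf_of_small (t ×ˢ Finset.range M)
    (fun p => {z | ∃ (x : Strip) (a : C), cov x ∈ S.attractor ∧ x.2 ∈ Ico (0 : ℝ) 1 ∧
      J x = p.2 ∧ ((h ^ K) a, p.1) ∈ dynEntourage h {q | dist q.1 q.2 < δ / 2} l ∧
      quot h (x, a) = z}) ?_ ?_
  · intro z hz
    obtain ⟨x, a, hx, rfl⟩ := exists_rep_mem_Ico h z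
    obtain ⟨c, hc, hca⟩ := ht (mem_univ ((h ^ K) a))
    exact ⟨(c, J x), Finset.mk_mem_product hc (Finset.mem_range.2 (hJ x)), x, a, hz, hx, rfl,
      hca, rfl⟩
  · rintro ⟨c, j⟩ - _ ⟨x, a, hx, hx2, hxj, hxa, rfl⟩ _ ⟨y, b, hy, hy2, hyj, hyb, rfl⟩
    rw [mem_dynEntourage]
    intro i hi
    rw [suspHomeo_iterate, suspHomeo_iterate]
    refine hδW _ _ _ _ (hcode x y hx hy hx2 hy2 (hxj.trans hyj.symm) i hi.le) ?_
    obtain ⟨h1, h2⟩ := hK x hx hx2 i hi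
    generalize ⌊(L.toHomeo^[i] x).2⌋ = k at h1 h2
    obtain ⟨m, rfl⟩ := Int.le.dest h1
    have hm : m < l := by
      push_cast at h2
      have : (m : ℝ) < l := by linarith
      exact_mod_cast this
    have e : ∀ c : C, (h ^ (K + (m : ℤ))) c = h^[m] ((h ^ K) c) := by
      intro c
      rw [add_comm, zpow_add, Homeomorph.mul_apply, zpow_natCast, homeomorph_pow_apply]
    have h3 : dist _ _ < δ / 2 := mem_dynEntourage.1 hxa m hm
    have h4 : dist _ _ < δ / 2 := mem_dynEntourage.1 hyb m hm
    rw [e, e]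
    have h5 := dist_triangle_right (h^[m] ((h ^ K) a)) (h^[m] ((h ^ K) b)) (h^[m] c)
    dsimp only at h3 h4
    linarith

theorem coverEntropy_suspHomeo_le (hα : α ≠ 0) (hrot : L.HasRotationNumber S.attractor α) {c : ℝ}
    (hc0 : 0 ≤ c) (hc : coverEntropy h univ ≤ (c : EReal)) :
    coverEntropy (suspHomeo h L) (pseudoSusp h S.attractor) ≤ ((|α| * c : ℝ) : EReal) := by
  have hα' : 0 < |α| := abs_pos.2 hα
  refine coverEntropy_le_of_exists_isDynCoverOf (mapsTo_suspHomeo_pseudoSusp h L S)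
    fun W hW c' hc' => ?_
  obtain ⟨η, hη, hηc⟩ : ∃ η > 0, (c + η) * (|α| + 2 * η) + η < c' := by
    have hcont : Tendsto (fun η : ℝ => (c + η) * (|α| + 2 * η) + η) (𝓝[>] 0)
        (𝓝 ((c + 0) * (|α| + 2 * 0) + 0)) :=
      (Continuous.tendsto (by fun_prop) 0).mono_left nhdsWithin_le_nhds
    have := hcont.eventually_lt_const (u := c') (by simpa [mul_comm] using hc')
    obtain ⟨η, hlt, hpos⟩ := (this.and self_mem_nhdsWithin).exists
    exact ⟨η, hpos, hlt⟩
  obtain ⟨V, hV, B, hcov⟩ := exists_cover_of_cover_fibre h hrot hW hη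
  have hslope : 0 < |α| + 2 * η := by positivity
  have ev1 := eventually_exists_isDynCoverOf hc hV (show c < c + η by linarith)
  have hlin : Tendsto (fun N : ℕ => (|α| + 2 * η) * (N : ℝ) + B) atTop atTop :=
    tendsto_atTop_add_const_right _ _
      ((tendsto_natCast_atTop_atTop (R := ℝ)).const_mul_atTop hslope)
  have ev2 := (tendsto_nat_ceil_atTop.comp hlin).eventually ev1
  have ev3 := (tendsto_natCast_atTop_atTop (R := ℝ)).const_mul_atTop
    (sub_pos.2 hηc) |>.eventually_ge_atTop ((c + η) * (B + 1))
  obtain ⟨N₀, hN₀⟩ := eventually_atTop.1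
    (ev2.and (ev3.and ((hlin.eventually_ge_atTop 0).and (eventually_gt_atTop 0))))
  obtain ⟨N, hN, hN'⟩ := hcov N₀
  obtain ⟨⟨t, ht, htcard⟩, h3, h4, h5⟩ := hN₀ N hN
  obtain ⟨s, hs, hscard⟩ := hN' _ (Nat.le_ceil _) t ht
  refine ⟨N, h5.ne', s, hs, hscard.trans ?_⟩
  calc (t.card : ℝ) * Real.exp (η * N)
      ≤ Real.exp ((c + η) * (⌈(|α| + 2 * η) * (N : ℝ) + B⌉₊ : ℕ)) * Real.exp (η * N) := by
        gcongr
        exact htcard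
    _ ≤ Real.exp (c' * N) := by
        rw [← Real.exp_add, Real.exp_le_exp]
        have h6 := mul_le_mul_of_nonneg_left (Nat.ceil_lt_add_one h4).le
          (show 0 ≤ c + η by linarith)
        linarith

end UpperBound

end HAK

theorem theorem6p1 {C : Type*} [MetricSpace C] [CompactSpace C] [TotallyDisconnectedSpace C]
    [PerfectSpace C] [Nonempty C] (h : C ≃ₜ C)
    (H : HAK.Annulus ≃ₜ HAK.Annulus) (S : HAK.HAKScheme H) (L : HAK.Lift H)
    (α : ℝ) (hα : α ≠ 0) (hrot : L.HasRotationNumber S.attractor α) :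
    Dynamics.coverEntropy (HAK.pseudoSuspHomeo h S L) univ =
      ((|α| : ℝ) : EReal) * Dynamics.coverEntropy h univ := by
  have hα' : 0 < |α| := abs_pos.2 hα
  have hrestrict : Dynamics.coverEntropy (HAK.pseudoSuspHomeo h S L) univ =
      Dynamics.coverEntropy (HAK.suspHomeo h L) (HAK.pseudoSusp h S.attractor) :=
    Dynamics.coverEntropy_restrict (HAK.mapsTo_suspHomeo_pseudoSusp h L S)
  have hne : (HAK.pseudoSusp h S.attractor).Nonempty := by
    obtain ⟨a, ha⟩ := S.nonempty_attractor
    obtain ⟨x, rfl⟩ := HAK.isQuotientMap_cov.surjective a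
    obtain ⟨c⟩ := ‹Nonempty C›
    exact ⟨HAK.quot h (x, c), ha⟩
  have hnonneg := Dynamics.coverEntropy_nonneg h (univ_nonempty (α := C))
  have hnonneg' := Dynamics.coverEntropy_nonneg (HAK.suspHomeo h L) hne
  rw [hrestrict]
  refine le_antisymm ?_ ?_
  -- The finite case carries the content; `⊥` is excluded because the spaces are nonempty, and `⊤`
  -- uses `|α| > 0`.
  · induction hc : Dynamics.coverEntropy h univ with
    | bot => simp [hc] at hnonneg
    | top => rw [EReal.coe_mul_top_of_pos hα']; exact le_top
    | coe c =>
      rw [hc] at hnonneg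
      rw [← EReal.coe_mul]
      exact HAK.coverEntropy_suspHomeo_le h hα hrot (by exact_mod_cast hnonneg) hc.le
  · induction hc : Dynamics.coverEntropy (HAK.suspHomeo h L) (HAK.pseudoSusp h S.attractor) with
    | bot => simp [hc] at hnonneg'
    | top => exact le_top
    | coe c =>
      rw [hc] at hnonneg'
      have h1 := HAK.coverEntropy_fibre_le h hα hrot (by exact_mod_cast hnonneg') hc.le
      have h2 : ((|α| : ℝ) : EReal) * Dynamics.coverEntropy h univ ≤
          ((|α| : ℝ) : EReal) * ((c / |α| : ℝ) : EReal) :=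
        mul_le_mul_of_nonneg_left h1 (by exact_mod_cast hα'.le)
      rwa [← EReal.coe_mul, mul_div_cancel₀ _ hα'.ne'] at h2
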